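/- For a graph $G$ on $n$ vertices let $\lambda_1\ge\lambda_2\ge\dots\ge\lambda_n$ be the eigenvalues of its adjacency matrix and let $\lambda(G)=\max_{2\le i\le n}|\lambda_i|$. For $0\le p\le 1$ let $G_p$ be the random subgraph of $G$ in which every edge of $G$ is kept independently with probability $p$. Let $\alpha\ge 0$ be a constant, and let $(G_i)_{i\ge 1}$ be a sequence of graphs, where $G_i$ is $d_i$-regular on $n_i$ vertices, such that $n_i\to\infty$, $d_i\to\infty$ and $\lambda(G_i)=o(d_i)$ as $i\to\infty$. Put $p_i=\min\{1,\alpha/d_i\}$ (so that $p_i=\alpha/d_i$ for all large $i$). (a) If $\alpha<1$, then there is a constant $C$ depending only on $\alpha$ such that, with probability tending to $1$ as $i\to\infty$, every connected component of $(G_i)_{p_i}$ has at most $C\log n_i$ vertices. (b) If $\alpha>1$, then the equation $xe^{-x}=\alpha e^{-\alpha}$ has exactly one real solution $\bar\alpha$ other than $\alpha$, and $\bar\alpha<1$. There is a constant $C$ depending only on $\alpha$ such that for every $\varepsilon>0$, with probability tending to $1$ as $i\to\infty$, there is a unique connected component of $(G_i)_{p_i}$ such that its number of vertices differs from $\left(1-\frac{\bar\alpha}{\alpha}\right)n_i$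 by at most $\varepsilon n_i$ and every other connected component has at most $C\log n_i$ vertices. -/

import Mathlib

open Filter Topology MeasureTheory ProbabilityTheory Asymptotics

noncomputable section

/-- `λ(G) = max_{2 ≤ i ≤ n} |λ_i|`, where `λ_1 ≥ λ_2 ≥ ⋯ ≥ λ_n` are the eigenvalues, with
multiplicity, of the adjacency matrix of `G`. They are indexed from `0` here, so that the index `0`,
that of the largest eigenvalue, is left out. -/
def secondEigenvalue {V : Type*} [Fintype V] [DecidableEq V] (G : SimpleGraph V)
    [DecidableRel G.Adj] : ℝ :=
  ⨆ i : {i : Fin (Fintype.card V) // 0 < i.val},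
    |(G.isHermitian_adjMatrix (R := ℝ)).eigenvalues₀ i.val|

/-- The law of the random subgraph `G_p`: every edge of `G` is kept independently with
probability `p`. -/
def randomSubgraph {V : Type*} (G : SimpleGraph V) (p : unitInterval) :
    Measure (SimpleGraph V) :=
  (setBernoulli G.edgeSet p).map SimpleGraph.fromEdgeSet

/-- The edge probability `p = α / d`, as an element of `[0, 1]`. (Where `α / d > 1`, which concerns
only finitely many terms when `d → ∞`, it is cut off at `1`.) -/
def edgeProb (α : ℝ) (d : ℕ) : unitInterval :=
  Set.projIcc 0 1 zero_le_one (α / d)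

/-- The number of vertices of a connected component. -/
def componentSize {V : Type*} {H : SimpleGraph V} (c : H.ConnectedComponent) : ℕ :=
  c.supp.ncard

/-- A sequence of graphs `G i`, where `G i` is `d i`-regular on the vertex set `Fin (n i)`, such
that `n → ∞`, `d → ∞` and `λ = o(d)`. -/
structure IsPseudoRandomSeq (n d : ℕ → ℕ) (G : (i : ℕ) → SimpleGraph (Fin (n i)))
    [∀ i, DecidableRel (G i).Adj] : Prop where
  regular : ∀ i, (G i).IsRegularOfDegree (d i)
  tendsto_card : Tendsto n atTop atTop
  tendsto_degree : Tendsto d atTop atTop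
  eigenvalue_isLittleO : (fun i => secondEigenvalue (G i)) =o[atTop] (fun i => (d i : ℝ))

end

/-! Revealing a component one vertex at a time resembles a branching process: an explored vertex has
about $d$ possible children, each kept with probability $\alpha/d$, so the offspring is nearly
Poisson($\alpha$). The extinction probability is the smallest fixed point $\eta$ of $y \mapsto
e^{-\alpha(1-y)}$; for $\alpha>1$ it equals $\bar\alpha/\alpha$. No coupling is built. Powers
$f^{|A|}$, with $A$ the set of active vertices, are carried through the exploration by induction
(`bernoulliMean_reach_le`, `bernoulliProb_reach_le`, `le_bernoulliProb_reach`), and all that is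
needed is that the base is a super- or subsolution of a fixed-point inequality.

For $\alpha<1$ this bounds an exponential moment of the component size, and a union bound over the
vertices gives logarithmic components.

For $\alpha>1$ pseudo-randomness enters twice, through the expander mixing lemma
`abs_cutCard_sub_le`. A set of $k\le\delta n$ vertices has at least $(1-2\delta)dk$ boundary edges,
all of which must be absent if the set is a component; an exponential moment that rewards boundary
edges excludes sizes between $C\log n$ and $\delta n$ (`bernoulliProb_cluster_medium`). A second
moment bound (`bernoulliProb_smallCount`) then puts about $(1-\eta)n$ vertices into components of
size above $\delta n$.

These are merged by sprinkling. Edges are first exposed with probability $\alpha_1/d$ for some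
$\alpha_1$ slightly below $\alpha$. Two large components of this round have order $dn$ edges of $G$
between them, so the second round joins all of them with high probability
(`bernoulliProb_not_connected_le`). The vertices in large components are almost equally many before
and after, which leaves no room for a second large component (`exists_giant`). -/

/-- The expectation of `f F`, where `F` is a random subset of `E` that contains every element
independently with probability `p`. -/
noncomputable def bernoulliMean {ι : Type*} [DecidableEq ι] (p : ℝ) (E : Finset ι)
    (f : Finset ι → ℝ) : ℝ :=
  ∑ F ∈ E.powerset, p ^ F.card * (1 - p) ^ (E \ F).card * f F

/-- The probability of the event `S` for a random subset of `E` that contains every element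
independently with probability `p`. -/
noncomputable def bernoulliProb {ι : Type*} [DecidableEq ι] (p : ℝ) (E : Finset ι)
    (S : Set (Finset ι)) : ℝ :=
  bernoulliMean p E (S.indicator 1)

/-! ### Expectations over independent random subsets -/

namespace bernoulliMean

variable {ι κ : Type*} [DecidableEq ι] [DecidableEq κ] {p : ℝ} {E : Finset ι}
  {f g : Finset ι → ℝ}

lemma empty (p : ℝ) (f : Finset ι → ℝ) : bernoulliMean p ∅ f = f ∅ := by
  simp [bernoulliMean]

lemma insert {e : ι} (he : e ∉ E) (p : ℝ) (f : Finset ι → ℝ) :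
    bernoulliMean p (insert e E) f =
      p * bernoulliMean p E (fun F => f (insert e F)) + (1 - p) * bernoulliMean p E f := by
  unfold bernoulliMean
  rw [Finset.sum_powerset_insert he, add_comm, Finset.mul_sum, Finset.mul_sum]
  congr 1
  · refine Finset.sum_congr rfl fun F hF => ?_
    have hF' := Finset.mem_powerset.1 hF
    have heF : e ∉ F := fun h => he (hF' h)
    have : (Insert.insert e E) \ (Insert.insert e F) = E \ F := by
      ext x; simp only [Finset.mem_sdiff, Finset.mem_insert]; grind
    rw [this, Finset.card_insert_of_notMem heF]
    ring
  · refine Finset.sum_congr rfl fun F hF => ?_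
    have hF' := Finset.mem_powerset.1 hF
    have heF : e ∉ F := fun h => he (hF' h)
    rw [Finset.insert_sdiff_of_notMem _ heF, Finset.card_insert_of_notMem (by simp [he])]
    ring

lemma congr (h : ∀ F ⊆ E, f F = g F) : bernoulliMean p E f = bernoulliMean p E g :=
  Finset.sum_congr rfl fun F hF => by rw [h F (Finset.mem_powerset.1 hF)]

lemma mono (h0 : 0 ≤ p) (h1 : p ≤ 1) (h : ∀ F ⊆ E, f F ≤ g F) :
    bernoulliMean p E f ≤ bernoulliMean p E g :=
  Finset.sum_le_sum fun F hF => mul_le_mul_of_nonneg_left (h F (Finset.mem_powerset.1 hF))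
    (mul_nonneg (pow_nonneg h0 _) (pow_nonneg (sub_nonneg.2 h1) _))

lemma const (p c : ℝ) (E : Finset ι) : bernoulliMean p E (fun _ => c) = c := by
  induction E using Finset.induction_on with
  | empty => simp [empty]
  | insert e E he ih => rw [insert he, ih]; ring

lemma add (p : ℝ) (E : Finset ι) (f g : Finset ι → ℝ) :
    bernoulliMean p E (fun F => f F + g F) = bernoulliMean p E f + bernoulliMean p E g := by
  simp only [bernoulliMean, mul_add, Finset.sum_add_distrib]

lemma const_mul (p c : ℝ) (E : Finset ι) (f : Finset ι → ℝ) :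
    bernoulliMean p E (fun F => c * f F) = c * bernoulliMean p E f := by
  simp only [bernoulliMean, Finset.mul_sum]
  exact Finset.sum_congr rfl fun F _ => by ring

lemma sub (p : ℝ) (E : Finset ι) (f g : Finset ι → ℝ) :
    bernoulliMean p E (fun F => f F - g F) = bernoulliMean p E f - bernoulliMean p E g := by
  simp only [bernoulliMean, mul_sub, Finset.sum_sub_distrib]

lemma sum {β : Type*} (p : ℝ) (E : Finset ι) (s : Finset β) (f : β → Finset ι → ℝ) :
    bernoulliMean p E (fun F => ∑ b ∈ s, f b F) = ∑ b ∈ s, bernoulliMean p E (f b) := by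
  simp only [bernoulliMean, Finset.mul_sum]
  exact Finset.sum_comm

lemma nonneg (h0 : 0 ≤ p) (h1 : p ≤ 1) (h : ∀ F ⊆ E, 0 ≤ f F) : 0 ≤ bernoulliMean p E f := by
  rw [← const p 0 E]; exact mono h0 h1 h

/-- Independence: the parts of the random set in disjoint index sets may be sampled one after the
other. -/
lemma union {E₁ E₂ : Finset ι} (h : Disjoint E₁ E₂) (p : ℝ) (f : Finset ι → ℝ) :
    bernoulliMean p (E₁ ∪ E₂) f =
      bernoulliMean p E₁ (fun F₁ => bernoulliMean p E₂ (fun F₂ => f (F₁ ∪ F₂))) := by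
  induction E₁ using Finset.induction_on generalizing f with
  | empty => simp [empty]
  | insert e E₁ he ih =>
    rw [Finset.disjoint_insert_left] at h
    rw [Finset.insert_union, insert (by simp [he, h.1]), insert he, ih h.2, ih h.2]
    simp only [Finset.insert_union]

lemma map (φ : κ ↪ ι) (M : Finset κ) (p : ℝ) (f : Finset ι → ℝ) :
    bernoulliMean p (M.map φ) f = bernoulliMean p M (fun B => f (B.map φ)) := by
  induction M using Finset.induction_on generalizing f with
  | empty => simp [empty]
  | insert e M he ih =>
    rw [Finset.map_insert, insert (by simpa using he), insert he, ih, ih]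
    simp only [Finset.map_insert]

/-- Two-round exposure. -/
lemma sprinkle {p p₁ p₂ : ℝ} (h : 1 - p = (1 - p₁) * (1 - p₂)) (E : Finset ι)
    (f : Finset ι → ℝ) :
    bernoulliMean p E f =
      bernoulliMean p₁ E (fun F₁ => bernoulliMean p₂ E (fun F₂ => f (F₁ ∪ F₂))) := by
  induction E using Finset.induction_on generalizing f with
  | empty => simp [empty]
  | insert e E he ih =>
    rw [insert he, insert he, ih, ih]
    simp only [insert he, add, const_mul, Finset.insert_union, Finset.union_insert,
      Finset.insert_idem]
    have : p = 1 - (1 - p₁) * (1 - p₂) := by linarith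
    rw [this]; ring

/-- Each element independently contributes a factor `a` if present and `b` if absent, so the mean is
a product. -/
lemma pow_card_mul_pow_card (p a b : ℝ) (E : Finset ι) :
    bernoulliMean p E (fun F => a ^ F.card * b ^ (E \ F).card) =
      (p * a + (1 - p) * b) ^ E.card := by
  rw [← Finset.sum_pow_mul_eq_add_pow]
  refine Finset.sum_congr rfl fun F hF => ?_
  rw [← Finset.card_sdiff_of_subset (Finset.mem_powerset.1 hF), mul_pow, mul_pow]
  ring

lemma pow_card (p a : ℝ) (E : Finset ι) :
    bernoulliMean p E (fun F => a ^ F.card) = (1 - p + p * a) ^ E.card := by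
  have := pow_card_mul_pow_card p a 1 E
  simp only [one_pow, mul_one] at this
  rw [this, add_comm]

end bernoulliMean

/-! ### Probabilities of events: Markov's inequality and union bounds -/

namespace bernoulliProb

variable {ι : Type*} [DecidableEq ι] {p : ℝ} {E : Finset ι} {S T : Set (Finset ι)}

lemma mono (h0 : 0 ≤ p) (h1 : p ≤ 1) (h : ∀ F ⊆ E, F ∈ S → F ∈ T) :
    bernoulliProb p E S ≤ bernoulliProb p E T := by
  refine bernoulliMean.mono h0 h1 fun F hF => ?_
  by_cases hS : F ∈ S
  · simp [hS, h F hF hS]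
  · simp only [hS, not_false_eq_true, Set.indicator_of_notMem]
    exact Set.indicator_nonneg (by simp) _

lemma nonneg (h0 : 0 ≤ p) (h1 : p ≤ 1) : 0 ≤ bernoulliProb p E S :=
  bernoulliMean.nonneg h0 h1 fun F _ => Set.indicator_nonneg (by simp) F

lemma le_one (h0 : 0 ≤ p) (h1 : p ≤ 1) : bernoulliProb p E S ≤ 1 := by
  rw [← bernoulliMean.const p 1 E]
  exact bernoulliMean.mono h0 h1 fun F _ => Set.indicator_le_self' (f := 1) (by simp) F

lemma compl (p : ℝ) (E : Finset ι) (S : Set (Finset ι)) :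
    bernoulliProb p E Sᶜ = 1 - bernoulliProb p E S := by
  rw [bernoulliProb, bernoulliProb, ← bernoulliMean.const p 1 E, ← bernoulliMean.sub]
  refine bernoulliMean.congr fun F _ => ?_
  by_cases hS : F ∈ S <;> simp [hS]

lemma markov (h0 : 0 ≤ p) (h1 : p ≤ 1) {f : Finset ι → ℝ} (hf : ∀ F ⊆ E, 0 ≤ f F)
    {c : ℝ} (hc : 0 < c) (hS : ∀ F ⊆ E, F ∈ S → c ≤ f F) :
    bernoulliProb p E S ≤ bernoulliMean p E f / c := by
  rw [le_div_iff₀ hc, mul_comm, bernoulliProb, ← bernoulliMean.const_mul]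
  refine bernoulliMean.mono h0 h1 fun F hF => ?_
  by_cases h : F ∈ S
  · simpa [h] using hS F hF h
  · simpa [h] using hf F hF

lemma le_sum {β : Type*} (h0 : 0 ≤ p) (h1 : p ≤ 1) (s : Finset β) {T : β → Set (Finset ι)}
    (h : ∀ F ⊆ E, F ∈ S → ∃ b ∈ s, F ∈ T b) :
    bernoulliProb p E S ≤ ∑ b ∈ s, bernoulliProb p E (T b) := by
  unfold bernoulliProb
  rw [← bernoulliMean.sum]
  refine bernoulliMean.mono h0 h1 fun F hF => ?_
  have hn : ∀ b ∈ s, 0 ≤ (T b).indicator (1 : Finset ι → ℝ) F := fun b _ =>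
    Set.indicator_nonneg (by simp) F
  by_cases hS : F ∈ S
  · obtain ⟨b, hb, hT⟩ := h F hF hS
    refine le_trans ?_ (Finset.single_le_sum hn hb)
    simp [hS, hT]
  · simpa [hS] using Finset.sum_nonneg hn

lemma le_add {T' : Set (Finset ι)} (h0 : 0 ≤ p) (h1 : p ≤ 1)
    (h : ∀ F ⊆ E, F ∈ S → F ∈ T ∨ F ∈ T') :
    bernoulliProb p E S ≤ bernoulliProb p E T + bernoulliProb p E T' := by
  have := le_sum (E := E) h0 h1 (Finset.univ : Finset Bool) (S := S)
    (T := fun b => if b then T else T') (fun F hF hS => by simpa [or_comm] using h F hF hS)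
  simpa using this

/-- The expected number of events that occur. -/
lemma mean_card_filter {β : Type*} (p : ℝ) (E : Finset ι) (s : Finset β)
    (T : β → Set (Finset ι)) [∀ F, DecidablePred fun b => F ∈ T b] :
    bernoulliMean p E (fun F => ((s.filter fun b => F ∈ T b).card : ℝ)) =
      ∑ b ∈ s, bernoulliProb p E (T b) := by
  unfold bernoulliProb
  rw [← bernoulliMean.sum]
  refine bernoulliMean.congr fun F _ => ?_
  rw [Finset.card_filter, Nat.cast_sum]
  refine Finset.sum_congr rfl fun b _ => ?_
  by_cases h : F ∈ T b <;> simp [h]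

end bernoulliProb

/-! ### Vocabulary of the exploration process -/

/-- The edges from `a` to other vertices, as an embedding. -/
def edgeFrom {V : Type*} (a : V) : V ↪ Sym2 V := ⟨fun b => s(a, b), fun _ _ h => Sym2.congr_right.1 h⟩

lemma edgeFrom_apply {V : Type*} (a b : V) : edgeFrom a b = s(a, b) := rfl

open Classical in
/-- The vertices that can be reached from `A` along edges in `F`, through vertices of `U`. -/
noncomputable def reach {V : Type*} [Fintype V] (F : Finset (Sym2 V)) (A U : Finset V) : Finset V :=
  Finset.univ.filter fun y => ∃ a ∈ A, Relation.ReflTransGen (fun x y => s(x, y) ∈ F ∧ y ∈ U) a y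

lemma mem_reach {V : Type*} [Fintype V] {F : Finset (Sym2 V)} {A U : Finset V} {y : V} :
    y ∈ reach F A U ↔
      ∃ a ∈ A, Relation.ReflTransGen (fun x y => s(x, y) ∈ F ∧ y ∈ U) a y := by
  simp [reach]

lemma subset_reach {V : Type*} [Fintype V] (F : Finset (Sym2 V)) (A U : Finset V) : A ⊆ reach F A U :=
  fun a ha => mem_reach.2 ⟨a, ha, .refl⟩

lemma reach_empty {V : Type*} [Fintype V] (F : Finset (Sym2 V)) (U : Finset V) : reach F ∅ U = ∅ := by
  ext y; simp [mem_reach]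

section Neighbors

variable {V : Type*} [DecidableEq V] {E : Finset (Sym2 V)} {A U B : Finset V} {a : V}

/-- The vertices of `U` that are joined to `a` by an edge in `E`. -/
def neighborsIn (E : Finset (Sym2 V)) (a : V) (U : Finset V) : Finset V :=
  U.filter fun b => s(a, b) ∈ E

lemma mem_neighborsIn {E : Finset (Sym2 V)} {a b : V} {U : Finset V} :
    b ∈ neighborsIn E a U ↔ b ∈ U ∧ s(a, b) ∈ E := Finset.mem_filter

lemma neighborsIn_subset (E : Finset (Sym2 V)) (a : V) (U : Finset V) :
    neighborsIn E a U ⊆ U := Finset.filter_subset _ _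

/-- The number of edges of `E` from `R` to `W`. -/
def cutCard (E : Finset (Sym2 V)) (R W : Finset V) : ℕ := ∑ r ∈ R, (neighborsIn E r W).card

lemma neighborsIn_mono (E : Finset (Sym2 V)) (a : V) {U W : Finset V} (h : U ⊆ W) :
    neighborsIn E a U ⊆ neighborsIn E a W := Finset.filter_subset_filter _ h

lemma disjoint_explored (hAU : Disjoint A U) :
    Disjoint (A.erase a ∪ B) (U \ B) := by
  rw [Finset.disjoint_left] at *
  intro x hx hx'
  simp only [Finset.mem_union, Finset.mem_erase, Finset.mem_sdiff] at hx hx'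
  exact hx.elim (fun h => hAU h.2 hx'.1) fun h => hx'.2 h

lemma card_explored (hAU : Disjoint A U) (hB : B ⊆ U) (ha : a ∈ A) :
    (A.erase a ∪ B).card = A.card - 1 + B.card := by
  rw [Finset.card_union_of_disjoint, Finset.card_erase_of_mem ha]
  exact (hAU.mono_left (Finset.erase_subset _ _)).mono_right hB

end Neighbors

/-! ### Exploration and comparison with branching processes -/

section Exploration

variable {V : Type*} [Fintype V] [DecidableEq V]

lemma reach_subset (F : Finset (Sym2 V)) (A U : Finset V) : reach F A U ⊆ A ∪ U := by
  intro y hy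
  obtain ⟨a, ha, h⟩ := mem_reach.1 hy
  rcases h.cases_tail with rfl | ⟨z, -, hz⟩
  · simp [ha]
  · simp [hz.2]

/-- The exploration inspects only edges that lead from `A ∪ U` into `U`. This locality is what keeps
the unrevealed edges independent of the past. -/
lemma reach_congr {F F' : Finset (Sym2 V)} {A U : Finset V}
    (h : ∀ x ∈ A ∪ U, ∀ y ∈ U, (s(x, y) ∈ F ↔ s(x, y) ∈ F')) :
    reach F A U = reach F' A U := by
  have key : ∀ F F' : Finset (Sym2 V),
      (∀ x ∈ A ∪ U, ∀ y ∈ U, (s(x, y) ∈ F ↔ s(x, y) ∈ F')) → reach F A U ⊆ reach F' A U := by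
    intro F F' h y hy
    obtain ⟨a, ha, hay⟩ := mem_reach.1 hy
    refine mem_reach.2 ⟨a, ha, ?_⟩
    clear hy
    induction hay with
    | refl => exact .refl
    | @tail b c hb hc ih =>
      have hb' : b ∈ A ∪ U := reach_subset F A U (mem_reach.2 ⟨a, ha, hb⟩)
      exact ih.tail ⟨(h b hb' c hc.2).1 hc.1, hc.2⟩
  exact (key F F' h).antisymm (key F' F fun x hx y hy => (h x hx y hy).symm)

/-- Exploring the neighbours of `a` first. -/
lemma reach_eq_insert (F : Finset (Sym2 V)) {A U : Finset V} {a : V} (ha : a ∈ A) :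
    reach F A U =
      insert a (reach F (A.erase a ∪ neighborsIn F a U) (U \ neighborsIn F a U)) := by
  set B := neighborsIn F a U with hB
  ext y
  constructor
  · intro hy
    obtain ⟨b, hb, hby⟩ := mem_reach.1 hy
    clear hy
    induction hby with
    | refl =>
      by_cases hba : b = a
      · simp [hba]
      · exact Finset.mem_insert_of_mem (subset_reach _ _ _ (by simp [hba, hb]))
    | @tail y z _ hz ih =>
      by_cases hzB : z ∈ B
      · exact Finset.mem_insert_of_mem (subset_reach _ _ _ (by simp [hzB]))
      rcases Finset.mem_insert.1 ih with rfl | ih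
      · exact absurd (mem_neighborsIn.2 ⟨hz.2, hz.1⟩) hzB
      · obtain ⟨c, hc, hcy⟩ := mem_reach.1 ih
        exact Finset.mem_insert_of_mem
          (mem_reach.2 ⟨c, hc, hcy.tail ⟨hz.1, Finset.mem_sdiff.2 ⟨hz.2, hzB⟩⟩⟩)
  · intro hy
    rcases Finset.mem_insert.1 hy with rfl | hy
    · exact subset_reach _ _ _ ha
    · obtain ⟨c, hc, hcy⟩ := mem_reach.1 hy
      have hcy' : Relation.ReflTransGen (fun x y => s(x, y) ∈ F ∧ y ∈ U) c y :=
        Relation.ReflTransGen.mono (fun _ _ h => ⟨h.1, (Finset.mem_sdiff.1 h.2).1⟩) _ _ hcy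
      rcases Finset.mem_union.1 hc with hc | hc
      · exact mem_reach.2 ⟨c, Finset.mem_of_mem_erase hc, hcy'⟩
      · have := mem_neighborsIn.1 hc
        exact mem_reach.2 ⟨a, ha, .head ⟨this.2, this.1⟩ hcy'⟩

/-- One step of the exploration: the edges from `a` to `U` are revealed. -/
lemma bernoulliMean_reach (p : ℝ) (E : Finset (Sym2 V)) (Φ : Finset V → ℝ) {A U : Finset V}
    {a : V} (ha : a ∈ A) (haU : a ∉ U) :
    bernoulliMean p E (fun F => Φ (reach F A U)) =
      bernoulliMean p (neighborsIn E a U) (fun B =>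
        bernoulliMean p E (fun F => Φ (insert a (reach F (A.erase a ∪ B) (U \ B))))) := by
  set M := neighborsIn E a U with hM
  set E₂ := M.map (edgeFrom a) with hE₂
  have hsub : E₂ ⊆ E := by
    intro e he
    obtain ⟨b, hb, rfl⟩ := Finset.mem_map.1 he
    exact (mem_neighborsIn.1 hb).2
  have hE : E = (E \ E₂) ∪ E₂ := (Finset.sdiff_union_of_subset hsub).symm
  have hdisj : Disjoint E₂ (E \ E₂) := Finset.disjoint_sdiff
  -- Every edge in `E₂` contains `a`, which is neither active nor unexplored from now on.
  have hloc : ∀ B ⊆ M, ∀ F₁ F₂ : Finset (Sym2 V), F₂ ⊆ E₂ →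
      reach (F₂ ∪ F₁) (A.erase a ∪ B) (U \ B) = reach F₁ (A.erase a ∪ B) (U \ B) := by
    intro B hB F₁ F₂ hF₂
    refine reach_congr fun x hx y hy => ?_
    have hxa : x ≠ a := by
      rintro rfl
      have hBU : x ∉ B := fun h => haU (neighborsIn_subset _ _ _ (hB h))
      simp [haU, hBU] at hx
    have hya : y ≠ a := by
      rintro rfl
      exact haU (Finset.mem_sdiff.1 hy).1
    simp only [Finset.mem_union, or_iff_right_iff_imp]
    intro h
    obtain ⟨b, -, hb⟩ := Finset.mem_map.1 (hF₂ h)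
    rw [edgeFrom_apply, Sym2.eq_iff] at hb
    rcases hb with ⟨rfl, -⟩ | ⟨rfl, -⟩
    exacts [absurd rfl hxa, absurd rfl hya]
  have hstep : bernoulliMean p E (fun F => Φ (reach F A U)) =
      bernoulliMean p E₂ (fun F₂ => bernoulliMean p (E \ E₂) (fun F₁ =>
        Φ (reach (F₂ ∪ F₁) A U))) := by
    conv_lhs => rw [hE, Finset.union_comm, bernoulliMean.union hdisj]
  rw [hstep, hE₂, bernoulliMean.map, ← hE₂]
  refine bernoulliMean.congr fun B hB => ?_
  have hE' : ∀ f : Finset (Sym2 V) → ℝ, bernoulliMean p E f =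
      bernoulliMean p E₂ (fun F₂ => bernoulliMean p (E \ E₂) (fun F₁ => f (F₂ ∪ F₁))) := by
    intro f
    conv_lhs => rw [hE, Finset.union_comm, bernoulliMean.union hdisj]
  rw [hE']
  -- The revealed edges no longer matter, so they can be resampled. Hence the later mean is again
  -- over all of `E`, and an induction need not track the revealed edges.
  have hconst : ∀ F₂ ⊆ E₂, bernoulliMean p (E \ E₂) (fun F₁ =>
        Φ (insert a (reach (F₂ ∪ F₁) (A.erase a ∪ B) (U \ B)))) =
      bernoulliMean p (E \ E₂) (fun F₁ =>
        Φ (insert a (reach F₁ (A.erase a ∪ B) (U \ B)))) := by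
    intro F₂ hF₂
    simp only [hloc B hB _ F₂ hF₂]
  rw [bernoulliMean.congr hconst, bernoulliMean.const]
  refine bernoulliMean.congr fun F₁ hF₁ => ?_
  have hBmap : B.map (edgeFrom a) ⊆ E₂ := Finset.map_subset_map.2 hB
  have hnb : neighborsIn (B.map (edgeFrom a) ∪ F₁) a U = B := by
    ext b
    rw [mem_neighborsIn, Finset.mem_union, ← edgeFrom_apply, Finset.mem_map' (edgeFrom a)]
    constructor
    · rintro ⟨hb, h | h⟩
      · exact h
      · exfalso
        have h' := Finset.mem_sdiff.1 (hF₁ h)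
        exact h'.2 ((Finset.mem_map' _).2 (mem_neighborsIn.2 ⟨hb, h'.1⟩))
    · exact fun h => ⟨neighborsIn_subset _ _ _ (hB h), .inl h⟩
  rw [reach_eq_insert _ ha, hnb, hloc B hB _ _ hBmap]

lemma notMem_reach_explored {A U B : Finset V} {a : V} (hAU : Disjoint A U) (hB : B ⊆ U) (ha : a ∈ A)
    (F : Finset (Sym2 V)) : a ∉ reach F (A.erase a ∪ B) (U \ B) := by
  have haU := Finset.disjoint_left.1 hAU ha
  intro h
  have := reach_subset _ _ _ h
  simp only [Finset.mem_union, Finset.mem_erase, Finset.mem_sdiff] at this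
  rcases this with (h | h) | h
  exacts [h.1 rfl, haU (hB h), haU h.1]

/-- An exponential moment of the number of vertices reached and the number of edges on the boundary
of the set of these vertices. -/
theorem bernoulliMean_reach_le {p x w f : ℝ} {d : ℕ} (h0 : 0 ≤ p) (h1 : p ≤ 1) (hx : 0 ≤ x)
    (hf : 0 ≤ f) (hw : 1 ≤ w) (hq : 1 ≤ p * f + (1 - p) * w)
    (hxq : x * (p * f + (1 - p) * w) ^ d ≤ f) {E : Finset (Sym2 V)}
    (hd : ∀ a, (neighborsIn E a Finset.univ).card ≤ d) (A U : Finset V) (hAU : Disjoint A U) :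
    bernoulliMean p E (fun F => x ^ (reach F A U).card *
      w ^ cutCard E (reach F A U) (U \ reach F A U)) ≤ f ^ A.card := by
  induction hn : (A ∪ U).card using Nat.strong_induction_on generalizing A U with
  | _ n ih =>
    rcases A.eq_empty_or_nonempty with rfl | ⟨a, ha⟩
    · simp [reach_empty, cutCard, bernoulliMean.const]
    have haU := Finset.disjoint_left.1 hAU ha
    rw [bernoulliMean_reach p E
      (fun R => x ^ R.card * w ^ cutCard E R (U \ R)) ha haU]
    set M := neighborsIn E a U with hM
    have hMU : M ⊆ U := neighborsIn_subset _ _ _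
    have hbound : ∀ B ⊆ M, bernoulliMean p E (fun F =>
          x ^ (insert a (reach F (A.erase a ∪ B) (U \ B))).card *
          w ^ cutCard E (insert a (reach F (A.erase a ∪ B) (U \ B)))
            (U \ insert a (reach F (A.erase a ∪ B) (U \ B)))) ≤
        x * f ^ (A.card - 1) * (f ^ B.card * w ^ (M \ B).card) := by
      intro B hB
      have hBU := hB.trans hMU
      have hlt : ((A.erase a ∪ B) ∪ (U \ B)).card < n := by
        rw [← hn]
        refine Finset.card_lt_card ⟨?_, ?_⟩
        · intro y hy
          simp only [Finset.mem_union, Finset.mem_erase, Finset.mem_sdiff] at hy ⊢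
          rcases hy with (h | h) | h
          exacts [.inl h.2, .inr (hBU h), .inr h.1]
        · intro h
          have := h (Finset.mem_union_left U ha)
          simp only [Finset.mem_union, Finset.mem_erase, Finset.mem_sdiff] at this
          rcases this with (h | h) | h
          exacts [h.1 rfl, haU (hBU h), haU h.1]
      have hI := ih _ hlt (A.erase a ∪ B) (U \ B) (disjoint_explored hAU) rfl
      rw [card_explored hAU hBU ha] at hI
      calc _ ≤ bernoulliMean p E (fun F => x * w ^ (M \ B).card *
              (x ^ (reach F (A.erase a ∪ B) (U \ B)).card *
              w ^ cutCard E (reach F (A.erase a ∪ B) (U \ B))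
                ((U \ B) \ reach F (A.erase a ∪ B) (U \ B)))) := by
            refine bernoulliMean.mono h0 h1 fun F _ => ?_
            set R := reach F (A.erase a ∪ B) (U \ B) with hR
            have haR : a ∉ R := notMem_reach_explored hAU hBU ha F
            have hBR : B ⊆ R := Finset.subset_union_right.trans (subset_reach _ _ _)
            have hUR : U \ insert a R = (U \ B) \ R := by
              ext y
              simp only [Finset.mem_sdiff, Finset.mem_insert, not_or]
              constructor
              · exact fun h => ⟨⟨h.1, fun hB => h.2.2 (hBR hB)⟩, h.2.2⟩
              · exact fun h => ⟨h.1.1, fun hya => haU (hya ▸ h.1.1), h.2⟩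
            -- Only an upper bound: an absent edge from `a` may lead to a vertex that is reached
            -- later by another route. Since `1 ≤ w`, overcounting the boundary is harmless.
            have hcut : cutCard E (insert a R) (U \ insert a R) ≤
                (M \ B).card + cutCard E R ((U \ B) \ R) := by
              rw [hUR, cutCard, Finset.sum_insert haR, cutCard]
              refine Nat.add_le_add_right (Finset.card_le_card ?_) _
              intro y hy
              rw [mem_neighborsIn, Finset.mem_sdiff, Finset.mem_sdiff] at hy
              exact Finset.mem_sdiff.2 ⟨mem_neighborsIn.2 ⟨hy.1.1.1, hy.2⟩, hy.1.1.2⟩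
            rw [Finset.card_insert_of_notMem haR]
            calc x ^ (R.card + 1) * w ^ cutCard E (insert a R) (U \ insert a R)
                ≤ x ^ (R.card + 1) * w ^ ((M \ B).card + cutCard E R ((U \ B) \ R)) := by
                  gcongr
              _ = _ := by ring
        _ = x * w ^ (M \ B).card * bernoulliMean p E (fun F =>
              (x ^ (reach F (A.erase a ∪ B) (U \ B)).card *
              w ^ cutCard E (reach F (A.erase a ∪ B) (U \ B))
                ((U \ B) \ reach F (A.erase a ∪ B) (U \ B)))) := bernoulliMean.const_mul _ _ _ _
        _ ≤ x * w ^ (M \ B).card * f ^ (A.card - 1 + B.card) := by gcongr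
        _ = _ := by rw [pow_add]; ring
    have hMd : M.card ≤ d :=
      (Finset.card_le_card (neighborsIn_mono E a (Finset.subset_univ U))).trans (hd a)
    have hA : A.card = A.card - 1 + 1 := by
      have := Finset.card_pos.2 ⟨a, ha⟩; omega
    calc _ ≤ bernoulliMean p M (fun B =>
            x * f ^ (A.card - 1) * (f ^ B.card * w ^ (M \ B).card)) :=
          bernoulliMean.mono h0 h1 hbound
      _ = x * f ^ (A.card - 1) * (p * f + (1 - p) * w) ^ M.card := by
          rw [bernoulliMean.const_mul, bernoulliMean.pow_card_mul_pow_card]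
      -- By `hq` the base is at least 1, so the exponent may be raised to the full degree.
      _ ≤ x * f ^ (A.card - 1) * (p * f + (1 - p) * w) ^ d := by gcongr
      _ = (x * (p * f + (1 - p) * w) ^ d) * f ^ (A.card - 1) := by ring
      _ ≤ f * f ^ (A.card - 1) := by gcongr
      _ = f ^ A.card := by rw [← pow_succ', ← hA]

lemma card_le_card_reach {V : Type*} [Fintype V] (F : Finset (Sym2 V)) (A U : Finset V) :
    A.card ≤ (reach F A U).card := Finset.card_le_card (subset_reach F A U)

lemma bernoulliProb_reach_of_lt (p : ℝ) (E : Finset (Sym2 V)) {A : Finset V} (U : Finset V) {K : ℕ}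
    (h : K < A.card) : bernoulliProb p E {F | (reach F A U).card ≤ K} = 0 := by
  rw [bernoulliProb, ← bernoulliMean.const p 0 E]
  refine bernoulliMean.congr fun F _ => Set.indicator_of_notMem ?_ _
  have := card_le_card_reach F A U
  simp only [Set.mem_ofPred_eq]; omega

/-- The explored vertex `a` is never met again and accounts for exactly one reached vertex, hence
the drop from `K + 1` to `K`. -/
lemma bernoulliProb_reach_step (p : ℝ) (E : Finset (Sym2 V)) {A U : Finset V} {a : V} {K : ℕ}
    (hAU : Disjoint A U) (ha : a ∈ A) :
    bernoulliProb p E {F | (reach F A U).card ≤ K + 1} =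
      bernoulliMean p (neighborsIn E a U) (fun B =>
        bernoulliProb p E {F | (reach F (A.erase a ∪ B) (U \ B)).card ≤ K}) := by
  have h := bernoulliMean_reach p E (fun R => {R : Finset V | R.card ≤ K + 1}.indicator 1 R) ha
    (Finset.disjoint_left.1 hAU ha)
  refine h.trans (bernoulliMean.congr fun B hB => bernoulliMean.congr fun F _ => ?_)
  have := notMem_reach_explored hAU (hB.trans (neighborsIn_subset _ _ _)) ha F
  simp only [Set.indicator, Set.mem_ofPred_eq, Finset.card_insert_of_notMem this,
    Nat.add_le_add_iff_right, Pi.one_apply]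

lemma card_compl_explored {U B : Finset V} (hB : B ⊆ U) :
    (U \ B)ᶜ.card = Uᶜ.card + B.card := by
  rw [Finset.card_compl, Finset.card_compl, Finset.card_sdiff_of_subset hB]
  have := Finset.card_le_card hB
  have := Finset.card_le_univ U
  omega

/-- While few vertices have left `U`, the number of possible children stays close to `d`. -/
lemma card_neighborsIn_ge {E : Finset (Sym2 V)} {d : ℕ}
    (hd : ∀ a, (neighborsIn E a Finset.univ).card = d) (a : V) (U : Finset V) :
    d - Uᶜ.card ≤ (neighborsIn E a U).card := by
  have : neighborsIn E a Finset.univ ⊆ neighborsIn E a U ∪ Uᶜ := by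
    intro b hb
    rw [mem_neighborsIn] at hb
    by_cases h : b ∈ U
    · exact Finset.mem_union_left _ (mem_neighborsIn.2 ⟨h, hb.2⟩)
    · exact Finset.mem_union_right _ (Finset.mem_compl.2 h)
  have := (Finset.card_le_card this).trans (Finset.card_union_le _ _)
  rw [hd] at this
  omega

/-- The probability that few vertices are reached is at most what it would be for a branching
process with extinction probability at most `y`. -/
theorem bernoulliProb_reach_le {p y : ℝ} {d K₀ : ℕ} (h0 : 0 ≤ p) (h1 : p ≤ 1) (hy : 0 ≤ y)
    (hy1 : y ≤ 1) (hyd : (1 - p + p * y) ^ (d - K₀) ≤ y) {E : Finset (Sym2 V)}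
    (hd : ∀ a, (neighborsIn E a Finset.univ).card = d) (K : ℕ) (A U : Finset V)
    (hAU : Disjoint A U) (hK : Uᶜ.card + K ≤ K₀ + A.card) :
    bernoulliProb p E {F | (reach F A U).card ≤ K} ≤ y ^ A.card := by
  induction K generalizing A U with
  | zero =>
    rcases A.eq_empty_or_nonempty with rfl | hA
    · simpa using bernoulliProb.le_one h0 h1
    · rw [bernoulliProb_reach_of_lt _ _ _ (Finset.card_pos.2 hA)]
      positivity
  | succ K ih =>
    rcases A.eq_empty_or_nonempty with rfl | ⟨a, ha⟩
    · simpa using bernoulliProb.le_one h0 h1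
    rcases lt_or_ge (K + 1) A.card with hlt | hge
    · rw [bernoulliProb_reach_of_lt _ _ _ hlt]
      positivity
    rw [bernoulliProb_reach_step p E hAU ha]
    have hA := Finset.card_pos.2 ⟨a, ha⟩
    have hq0 : 0 ≤ 1 - p + p * y := add_nonneg (sub_nonneg.2 h1) (mul_nonneg h0 hy)
    have hq1 : 1 - p + p * y ≤ 1 := by nlinarith
    calc _ ≤ bernoulliMean p (neighborsIn E a U) (fun B => y ^ (A.card - 1) * y ^ B.card) := by
          refine bernoulliMean.mono h0 h1 fun B hB => ?_
          have hBU := hB.trans (neighborsIn_subset _ _ _)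
          rw [← pow_add, ← card_explored hAU hBU ha]
          refine ih _ _ (disjoint_explored hAU) ?_
          -- The quantity `Uᶜ.card + K - A.card` is invariant: the first term gains `B.card`, `K`
          -- drops by 1, and `A.card` changes by `B.card - 1`.
          rw [card_compl_explored hBU, card_explored hAU hBU ha]
          omega
      _ = y ^ (A.card - 1) * (1 - p + p * y) ^ (neighborsIn E a U).card := by
          rw [bernoulliMean.const_mul, bernoulliMean.pow_card]
      _ ≤ y ^ (A.card - 1) * (1 - p + p * y) ^ (d - K₀) := by
          refine mul_le_mul_of_nonneg_left (pow_le_pow_of_le_one hq0 hq1 ?_) (by positivity)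
          -- The invariant together with `A.card ≤ K + 1` gives `Uᶜ.card ≤ K₀`.
          have := card_neighborsIn_ge hd a U
          omega
      _ ≤ y ^ (A.card - 1) * y := by gcongr
      _ = y ^ A.card := by rw [← pow_succ]; congr 1; omega

/-- The probability that few vertices are reached is at least what it would be for a branching
process with extinction probability at least `y`, up to an error that is exponentially small in the
number of vertices. -/
theorem le_bernoulliProb_reach {p y g t : ℝ} {d K₀ : ℕ} (h0 : 0 ≤ p) (h1 : p ≤ 1) (hy : 0 ≤ y)
    (hy1 : y ≤ 1) (hg : 0 ≤ g) (hg1 : g ≤ 1) (ht : 0 ≤ t) (ht1 : t ≤ 1) (hygt : y ≤ g * t)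
    (hyd : y ≤ (1 - p + p * y) ^ d) (hgd : (1 - p + p * g) ^ (d - K₀) ≤ t * g)
    {E : Finset (Sym2 V)} (hd : ∀ a, (neighborsIn E a Finset.univ).card = d) (K : ℕ)
    (A U : Finset V) (hAU : Disjoint A U) (hK : Uᶜ.card + K ≤ K₀ + A.card) :
    y ^ A.card - g ^ A.card * t ^ K ≤ bernoulliProb p E {F | (reach F A U).card ≤ K} := by
  -- With more than `K` active vertices the event is impossible; `y ≤ g * t` makes the error term
  -- absorb the main term.
  have hbig : ∀ (K : ℕ) (A : Finset V), K < A.card → y ^ A.card - g ^ A.card * t ^ K ≤ 0 := by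
    intro K A hKA
    have : y ^ A.card ≤ (g * t) ^ A.card := by gcongr
    rw [mul_pow] at this
    have h2 : t ^ A.card ≤ t ^ K := pow_le_pow_of_le_one ht ht1 hKA.le
    have := this.trans (mul_le_mul_of_nonneg_left h2 (pow_nonneg hg A.card))
    linarith
  have hempty : ∀ (U : Finset V) (K : ℕ), y ^ (∅ : Finset V).card - g ^ (∅ : Finset V).card * t ^ K ≤
      bernoulliProb p E {F | (reach F ∅ U).card ≤ K} := by
    intro U K
    have : bernoulliProb p E {F | (reach F ∅ U).card ≤ K} = 1 := by
      rw [bernoulliProb, ← bernoulliMean.const p 1 E]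
      exact bernoulliMean.congr fun F _ => by simp [reach_empty]
    rw [this]
    have : 0 ≤ t ^ K := by positivity
    simpa
  induction K generalizing A U with
  | zero =>
    rcases A.eq_empty_or_nonempty with rfl | hA
    · exact hempty U 0
    · exact (hbig 0 A (Finset.card_pos.2 hA)).trans (bernoulliProb.nonneg h0 h1)
  | succ K ih =>
    rcases A.eq_empty_or_nonempty with rfl | ⟨a, ha⟩
    · exact hempty U _
    rcases lt_or_ge (K + 1) A.card with hlt | hge
    · exact (hbig _ A hlt).trans (bernoulliProb.nonneg h0 h1)
    rw [bernoulliProb_reach_step p E hAU ha]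
    have hA := Finset.card_pos.2 ⟨a, ha⟩
    have hA' : A.card = A.card - 1 + 1 := by omega
    set M := neighborsIn E a U with hM
    have hMd : M.card ≤ d :=
      (Finset.card_le_card (neighborsIn_mono E a (Finset.subset_univ U))).trans (hd a).le
    have hdM : d - K₀ ≤ M.card := by
      have := card_neighborsIn_ge hd a U
      rw [← hM] at this
      omega
    have hy' : y ≤ (1 - p + p * y) ^ M.card :=
      hyd.trans (pow_le_pow_of_le_one (add_nonneg (sub_nonneg.2 h1) (mul_nonneg h0 hy))
        (by nlinarith) hMd)
    have hg' : (1 - p + p * g) ^ M.card ≤ t * g :=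
      (pow_le_pow_of_le_one (add_nonneg (sub_nonneg.2 h1) (mul_nonneg h0 hg))
        (by nlinarith) hdM).trans hgd
    -- The term `y ^ A.card` comes from a subsolution, using at most `d` children. The error term
    -- comes from a strict supersolution `g`, using at least `d - K₀` children, and gains a factor
    -- `t` at each step.
    calc y ^ A.card - g ^ A.card * t ^ (K + 1)
        = y ^ (A.card - 1) * y - g ^ (A.card - 1) * t ^ K * (t * g) := by
          conv_lhs => rw [hA']
          ring
      _ ≤ y ^ (A.card - 1) * (1 - p + p * y) ^ M.card -
          g ^ (A.card - 1) * t ^ K * (1 - p + p * g) ^ M.card := by gcongr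
      _ = bernoulliMean p M (fun B => y ^ (A.card - 1) * y ^ B.card -
            g ^ (A.card - 1) * t ^ K * g ^ B.card) := by
          rw [bernoulliMean.sub, bernoulliMean.const_mul, bernoulliMean.const_mul,
            bernoulliMean.pow_card, bernoulliMean.pow_card]
      _ ≤ _ := by
          refine bernoulliMean.mono h0 h1 fun B hB => ?_
          have hBU := hB.trans (neighborsIn_subset _ _ _)
          have h := ih (A.erase a ∪ B) (U \ B) (disjoint_explored hAU) (by
            rw [card_compl_explored hBU, card_explored hAU hBU ha]
            omega)
          rw [card_explored hAU hBU ha, pow_add, pow_add] at h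
          linarith

end Exploration

/-! ### Clusters and connected components -/

section Cluster

variable {V : Type*} [Fintype V] [DecidableEq V]

/-- The vertex set of the connected component of `v` in the graph with edge set `F`. -/
noncomputable def cluster (F : Finset (Sym2 V)) (v : V) : Finset V := reach F {v} {v}ᶜ

lemma reachable_of_mem_reach {F : Finset (Sym2 V)} {A U : Finset V} {y : V}
    (hy : y ∈ reach F A U) :
    ∃ a ∈ A, (SimpleGraph.fromEdgeSet (F : Set (Sym2 V))).Reachable a y := by
  obtain ⟨a, ha, h⟩ := mem_reach.1 hy
  refine ⟨a, ha, ?_⟩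
  clear hy
  induction h with
  | refl => exact .rfl
  | @tail b c _ hc ih =>
    by_cases hbc : b = c
    · exact hbc ▸ ih
    · exact ih.trans (SimpleGraph.Adj.reachable
        ((SimpleGraph.fromEdgeSet_adj _).2 ⟨by exact_mod_cast hc.1, hbc⟩))

lemma mem_cluster {F : Finset (Sym2 V)} {v y : V} :
    y ∈ cluster F v ↔ (SimpleGraph.fromEdgeSet (F : Set (Sym2 V))).Reachable v y := by
  constructor
  · intro h
    obtain ⟨a, ha, h⟩ := reachable_of_mem_reach h
    rwa [Finset.mem_singleton.1 ha] at h
  · intro h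
    rw [SimpleGraph.reachable_iff_reflTransGen] at h
    induction h with
    | refl => exact subset_reach _ _ _ (by simp)
    | @tail b c _ hc ih =>
      by_cases hcv : c = v
      · exact subset_reach _ _ _ (by simp [hcv])
      obtain ⟨a, ha, hab⟩ := mem_reach.1 ih
      refine mem_reach.2 ⟨a, ha, hab.tail ⟨?_, by simpa using hcv⟩⟩
      exact_mod_cast ((SimpleGraph.fromEdgeSet_adj _).1 hc).1

lemma mem_cluster_self (F : Finset (Sym2 V)) (v : V) : v ∈ cluster F v := mem_cluster.2 .rfl

lemma cluster_eq_of_mem {F : Finset (Sym2 V)} {v w : V} (h : w ∈ cluster F v) :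
    cluster F w = cluster F v := by
  rw [mem_cluster] at h
  ext y
  rw [mem_cluster, mem_cluster]
  exact ⟨h.trans, h.symm.trans⟩

lemma cluster_mono {F F' : Finset (Sym2 V)} (h : F ⊆ F') (v : V) :
    cluster F v ⊆ cluster F' v := by
  intro y hy
  rw [mem_cluster] at hy ⊢
  exact hy.mono (SimpleGraph.fromEdgeSet_mono (by exact_mod_cast h))

lemma mem_cluster_of_edge {F : Finset (Sym2 V)} {v x y : V} (hx : x ∈ cluster F v)
    (hxy : s(x, y) ∈ F) : y ∈ cluster F v := by
  by_cases h : x = y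
  · exact h ▸ hx
  rw [mem_cluster] at hx ⊢
  exact hx.trans (SimpleGraph.Adj.reachable
    ((SimpleGraph.fromEdgeSet_adj _).2 ⟨by exact_mod_cast hxy, h⟩))

lemma disjoint_cluster {F : Finset (Sym2 V)} {v w : V} (h : w ∉ cluster F v) :
    Disjoint (cluster F v) (cluster F w) := by
  rw [Finset.disjoint_left]
  intro y hv hw
  exact h (cluster_eq_of_mem hv ▸ cluster_eq_of_mem hw ▸ mem_cluster_self F w)

lemma reach_pair_subset (F : Finset (Sym2 V)) (v w : V) (U : Finset V) :
    reach F {v, w} U ⊆ cluster F v ∪ cluster F w := by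
  intro y hy
  obtain ⟨a, ha, h⟩ := reachable_of_mem_reach hy
  rw [Finset.mem_union, mem_cluster, mem_cluster]
  simp only [Finset.mem_insert, Finset.mem_singleton] at ha
  rcases ha with rfl | rfl
  exacts [.inl h, .inr h]

lemma componentSize_connectedComponentMk (F : Finset (Sym2 V)) (v : V) :
    componentSize ((SimpleGraph.fromEdgeSet (F : Set (Sym2 V))).connectedComponentMk v) =
      (cluster F v).card := by
  rw [componentSize, ← Set.ncard_coe_finset]
  congr 1
  ext y
  rw [SimpleGraph.ConnectedComponent.mem_supp_iff, SimpleGraph.ConnectedComponent.eq,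
    Finset.mem_coe, mem_cluster]
  exact ⟨.symm, .symm⟩

lemma connectedComponentMk_eq_iff {F : Finset (Sym2 V)} {v w : V} :
    (SimpleGraph.fromEdgeSet (F : Set (Sym2 V))).connectedComponentMk v =
      (SimpleGraph.fromEdgeSet (F : Set (Sym2 V))).connectedComponentMk w ↔
      w ∈ cluster F v := by
  rw [SimpleGraph.ConnectedComponent.eq, mem_cluster]

end Cluster

/-! ### From the measure on graphs to finite sums -/

section Measure

variable {V : Type*} [Fintype V] [DecidableEq V]

/-- The measure is carried by the finitely many subsets of `E`, so the probability is the sum over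
singletons. -/
lemma setBernoulli_real_eq_bernoulliProb {ι : Type*} [Fintype ι] [DecidableEq ι] (E : Finset ι)
    (p : unitInterval) (T : Set (Set ι)) :
    (setBernoulli (E : Set ι) p).real T = bernoulliProb p E {F | (F : Set ι) ∈ T} := by
  classical
  have h1 : (setBernoulli (E : Set ι) p).real T =
      (setBernoulli (E : Set ι) p).real
        (⋃ F ∈ E.powerset.filter (fun F : Finset ι => (F : Set ι) ∈ T), {(F : Set ι)}) := by
    rw [measureReal_def, setBernoulli_apply_eq_apply_subsets, measureReal_def]
    congr 2
    ext s
    simp only [Set.mem_ofPred_eq, Set.mem_iUnion, Set.mem_singleton_iff, Finset.mem_filter,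
      Finset.mem_powerset, exists_prop]
    constructor
    · rintro ⟨hs, hsE⟩
      refine ⟨s.toFinset, ⟨?_, by simpa using hs⟩, by simp⟩
      intro x hx
      exact_mod_cast hsE (by simpa using hx)
    · rintro ⟨F, ⟨hF, hT⟩, rfl⟩
      exact ⟨hT, by exact_mod_cast hF⟩
  rw [h1, measureReal_biUnion_finset]
  · rw [bernoulliProb, bernoulliMean, Finset.sum_filter]
    refine Finset.sum_congr rfl fun F hF => ?_
    have hF' : (F : Set ι) ⊆ E := by exact_mod_cast Finset.mem_powerset.1 hF
    by_cases h : (F : Set ι) ∈ T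
    · rw [if_pos h, setBernoulli_real_singleton p hF' E.finite_toSet, Set.ncard_coe_finset,
        ← Finset.coe_sdiff, Set.ncard_coe_finset]
      simp [Set.indicator, h]
    · simp [Set.indicator, h]
  · intro F _ F' _ hne
    simpa [Function.onFun] using hne
  · intro F _
    exact measurableSet_singleton _

lemma measurableSet_simpleGraph {V : Type*} [Finite V] (S : Set (SimpleGraph V)) : MeasurableSet S := by
  have h : MeasurableSet (SimpleGraph.edgeSet '' S) := Set.Finite.measurableSet (Set.toFinite _)
  rw [← Set.preimage_image_eq S SimpleGraph.edgeSet_injective]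
  exact SimpleGraph.measurable_edgeSet h

/-- The law of the random subgraph as a finite sum. -/
lemma randomSubgraph_real (G : SimpleGraph V) [DecidableRel G.Adj] (p : unitInterval)
    (S : Set (SimpleGraph V)) :
    (randomSubgraph G p).real S =
      bernoulliProb p G.edgeFinset
        {F | SimpleGraph.fromEdgeSet (F : Set (Sym2 V)) ∈ S} := by
  rw [randomSubgraph, map_measureReal_apply SimpleGraph.measurable_fromEdgeSet
    (measurableSet_simpleGraph S), ← SimpleGraph.coe_edgeFinset,
    setBernoulli_real_eq_bernoulliProb]
  rfl

lemma card_neighborsIn_edgeFinset {G : SimpleGraph V} [DecidableRel G.Adj] {d : ℕ}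
    (h : G.IsRegularOfDegree d) (a : V) :
    (neighborsIn G.edgeFinset a Finset.univ).card = d := by
  rw [← h a, ← SimpleGraph.card_neighborFinset_eq_degree]
  congr 1
  ext b
  simp [mem_neighborsIn]

end Measure

/-! ### Spectral gap and the expander mixing lemma -/

section Mixing

open Matrix

variable {V : Type*} [Fintype V] [DecidableEq V]

/-- Parseval's identity for an orthonormal basis of a space of functions. -/
lemma OrthonormalBasis.sum_dotProduct_mul_dotProduct {ι V : Type*} [Fintype V] [Fintype ι]
    (b : OrthonormalBasis ι ℝ (EuclideanSpace ℝ V)) (x y : V → ℝ) :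
    ∑ i, (x ⬝ᵥ (b i : V → ℝ)) * ((b i : V → ℝ) ⬝ᵥ y) = x ⬝ᵥ y := by
  have h := b.sum_inner_mul_inner (WithLp.toLp 2 x) (WithLp.toLp 2 y)
  simp only [EuclideanSpace.inner_eq_star_dotProduct, star_trivial] at h
  rw [dotProduct_comm x y, ← h]
  refine Finset.sum_congr rfl fun i _ => ?_
  rw [dotProduct_comm x, dotProduct_comm _ y]

variable (G : SimpleGraph V) [DecidableRel G.Adj]

lemma abs_eigenvalue_le_secondEigenvalue {i : Fin (Fintype.card V)} (hi : 0 < i.val) :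
    |(G.isHermitian_adjMatrix (R := ℝ)).eigenvalues₀ i| ≤ secondEigenvalue G :=
  le_ciSup (f := fun i : {i : Fin (Fintype.card V) // 0 < i.val} =>
    |(G.isHermitian_adjMatrix (R := ℝ)).eigenvalues₀ i.val|) (Set.finite_range _).bddAbove ⟨i, hi⟩

variable {G}

/-- In an eigenbasis, `x` has no component along the eigenvector with index 0, and all other
eigenvalues are at most `secondEigenvalue G` in absolute value. The arithmetic mean of the squared
norms replaces the usual product of norms, so the estimate can be made coordinate by coordinate. -/
lemma abs_dotProduct_adjMatrix_mulVec_le {d : ℕ} (hG : G.IsRegularOfDegree d)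
    (hd : secondEigenvalue G < d) {x y : V → ℝ} (hx : x ⬝ᵥ 1 = 0) :
    |x ⬝ᵥ (G.adjMatrix ℝ *ᵥ y)| ≤ secondEigenvalue G * ((x ⬝ᵥ x + y ⬝ᵥ y) / 2) := by
  set hA := G.isHermitian_adjMatrix (R := ℝ)
  set b := hA.eigenvectorBasis
  set e : V ≃ Fin (Fintype.card V) := (Fintype.equivOfCardEq (Fintype.card_fin _)).symm
  have heig : ∀ i (z : V → ℝ), (b i : V → ℝ) ⬝ᵥ (G.adjMatrix ℝ *ᵥ z) =
      hA.eigenvalues i * ((b i : V → ℝ) ⬝ᵥ z) := by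
    intro i z
    rw [dotProduct_mulVec, ← mulVec_transpose, G.transpose_adjMatrix,
      hA.mulVec_eigenvectorBasis, smul_dotProduct]
    rfl
  have hle : ∀ i, 0 < (e i).val → |hA.eigenvalues i| ≤ secondEigenvalue G :=
    fun i hi => abs_eigenvalue_le_secondEigenvalue G hi
  have hA1 : G.adjMatrix ℝ *ᵥ (1 : V → ℝ) = (d : ℝ) • (1 : V → ℝ) := by
    ext v
    have := SimpleGraph.adjMatrix_mulVec_const_apply_of_regular (α := ℝ) (a := 1) hG (v := v)
    simpa using this
  -- The vector `1` has eigenvalue `d`, which differs from every eigenvalue of positive index.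
  have horth : ∀ i, 0 < (e i).val → (b i : V → ℝ) ⬝ᵥ (1 : V → ℝ) = 0 := by
    intro i hi
    have h := heig i 1
    rw [hA1, dotProduct_smul, smul_eq_mul] at h
    have hne : (d : ℝ) - hA.eigenvalues i ≠ 0 := by
      have := (abs_le.1 (hle i hi)).2
      linarith
    exact (mul_eq_zero.1 (by linarith : ((d : ℝ) - hA.eigenvalues i) *
      ((b i : V → ℝ) ⬝ᵥ (1 : V → ℝ)) = 0)).resolve_left hne
  -- Thus `1` is a nonzero multiple of `b j`, and `x` is orthogonal to it. That the top eigenvalue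
  -- is `d` is not needed.
  have htop : ∀ j, (e j).val = 0 → x ⬝ᵥ (b j : V → ℝ) = 0 := by
    intro j hj
    have hother : ∀ i, i ≠ j → (b i : V → ℝ) ⬝ᵥ (1 : V → ℝ) = 0 := by
      intro i hij
      refine horth i (Nat.pos_of_ne_zero fun h => hij (e.injective (Fin.ext (h.trans hj.symm))))
    have h1 := b.sum_dotProduct_mul_dotProduct 1 1
    rw [Finset.sum_eq_single j (fun i _ hij => by rw [hother i hij, mul_zero]) (by simp)] at h1
    have h2 := b.sum_dotProduct_mul_dotProduct x 1
    rw [Finset.sum_eq_single j (fun i _ hij => by rw [hother i hij, mul_zero]) (by simp), hx] at h2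
    refine (mul_eq_zero.1 h2).resolve_right fun h => ?_
    rw [h, mul_zero] at h1
    have : (0 : ℝ) < (1 : V → ℝ) ⬝ᵥ 1 := by
      have : 0 < Fintype.card V := Fintype.card_pos_iff.2 ⟨j⟩
      simpa [dotProduct] using this
    linarith
  rw [← b.sum_dotProduct_mul_dotProduct x (G.adjMatrix ℝ *ᵥ y),
    ← b.sum_dotProduct_mul_dotProduct x x, ← b.sum_dotProduct_mul_dotProduct y y,
    ← Finset.sum_add_distrib, Finset.sum_div, Finset.mul_sum]
  refine (Finset.abs_sum_le_sum_abs _ _).trans (Finset.sum_le_sum fun i _ => ?_)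
  rw [heig, dotProduct_comm _ x, dotProduct_comm _ y]
  have hsec : 0 ≤ secondEigenvalue G := Real.iSup_nonneg fun _ => abs_nonneg _
  rcases Nat.eq_zero_or_pos (e i).val with h | h
  · rw [htop i h]
    simp only [zero_mul, abs_zero, zero_add]
    have := mul_self_nonneg (y ⬝ᵥ (b i : V → ℝ))
    positivity
  · have h1 := hle i h
    set u := x ⬝ᵥ (b i : V → ℝ)
    set v := y ⬝ᵥ (b i : V → ℝ)
    have h2 : |u * (hA.eigenvalues i * v)| = |hA.eigenvalues i| * |u * v| := by
      rw [← abs_mul]; congr 1; ring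
    rw [h2]
    refine mul_le_mul h1 ?_ (abs_nonneg _) hsec
    rw [abs_le]
    constructor <;> nlinarith [sq_nonneg (u + v), sq_nonneg (u - v)]

/-- The **expander mixing lemma**. -/
theorem abs_cutCard_sub_le {d : ℕ} (hG : G.IsRegularOfDegree d)
    (hd : secondEigenvalue G < d) (S T : Finset V) :
    |(cutCard G.edgeFinset S T : ℝ) - d * S.card * T.card / Fintype.card V| ≤
      secondEigenvalue G * ((S.card - (S.card : ℝ) ^ 2 / Fintype.card V +
        (T.card - (T.card : ℝ) ^ 2 / Fintype.card V)) / 2) := by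
  rcases isEmpty_or_nonempty V with hV | hV
  · simp [Finset.eq_empty_of_isEmpty, cutCard]
  set n : ℝ := (Fintype.card V : ℝ) with hn
  have hn0 : 0 < n := by
    rw [hn]; exact_mod_cast Fintype.card_pos
  let ind : Finset V → V → ℝ := fun S v => if v ∈ S then 1 else 0
  -- The indicator projected orthogonally to the constants.
  let c : Finset V → V → ℝ := fun S => ind S - ((S.card : ℝ) / n) • (1 : V → ℝ)
  have hind1 : ∀ S, ind S ⬝ᵥ 1 = S.card := fun S => by simp [ind, dotProduct]
  have h1ind : ∀ S, (1 : V → ℝ) ⬝ᵥ ind S = S.card := fun S => by rw [dotProduct_comm, hind1]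
  have hindind : ∀ S, ind S ⬝ᵥ ind S = S.card := fun S => by simp [ind, dotProduct]
  have h11 : (1 : V → ℝ) ⬝ᵥ 1 = n := by simp [dotProduct, hn]
  have hc1 : ∀ S, c S ⬝ᵥ 1 = 0 := by
    intro S
    simp only [c, sub_dotProduct, smul_dotProduct, hind1, h11, smul_eq_mul]
    field_simp; ring
  have hcc : ∀ S, c S ⬝ᵥ c S = S.card - (S.card : ℝ) ^ 2 / n := by
    intro S
    simp only [c, sub_dotProduct, smul_dotProduct, dotProduct_sub, dotProduct_smul, hind1, h1ind,
      hindind, h11, smul_eq_mul]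
    field_simp; ring
  have hA1 : G.adjMatrix ℝ *ᵥ (1 : V → ℝ) = (d : ℝ) • (1 : V → ℝ) := by
    ext v
    have := SimpleGraph.adjMatrix_mulVec_const_apply_of_regular (α := ℝ) (a := 1) hG (v := v)
    simpa using this
  have h1A : ∀ z : V → ℝ, (1 : V → ℝ) ⬝ᵥ (G.adjMatrix ℝ *ᵥ z) = d * ((1 : V → ℝ) ⬝ᵥ z) := by
    intro z
    rw [dotProduct_mulVec, ← mulVec_transpose, G.transpose_adjMatrix, hA1, smul_dotProduct,
      smul_eq_mul]
  have hcut : ind S ⬝ᵥ (G.adjMatrix ℝ *ᵥ ind T) = cutCard G.edgeFinset S T := by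
    rw [SimpleGraph.dotProduct_mulVec_adjMatrix, cutCard, Nat.cast_sum,
      ← Finset.sum_subset (Finset.subset_univ S)
        (fun i _ hi => Finset.sum_eq_zero fun j _ => by simp [ind, hi])]
    refine Finset.sum_congr rfl fun i hi => ?_
    rw [← Finset.sum_subset (Finset.subset_univ T) (fun j _ hj => by simp [ind, hj]), neighborsIn,
      Finset.card_filter, Nat.cast_sum]
    refine Finset.sum_congr rfl fun j hj => ?_
    simp [ind, hi, hj]
  have hcAc : c S ⬝ᵥ (G.adjMatrix ℝ *ᵥ c T) =
      cutCard G.edgeFinset S T - d * S.card * T.card / n := by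
    simp only [c, mulVec_sub, mulVec_smul, hA1, sub_dotProduct, smul_dotProduct, dotProduct_sub,
      dotProduct_smul, h1A, hcut, hind1, h1ind, h11, smul_eq_mul]
    field_simp; ring
  have := abs_dotProduct_adjMatrix_mulVec_le hG hd (y := c T) (hc1 S)
  rwa [hcAc, hcc, hcc] at this

/-- Every set that is not too large has a large edge boundary. -/
lemma le_cutCard_compl {d : ℕ} (hG : G.IsRegularOfDegree d) {δ : ℝ}
    (hd0 : 0 < d) (hδ1 : δ < 1)
    (hd : secondEigenvalue G ≤ δ * d) {S : Finset V} (hS : (S.card : ℝ) ≤ δ * Fintype.card V) :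
    (1 - 2 * δ) * d * S.card ≤ cutCard G.edgeFinset S Sᶜ := by
  rcases isEmpty_or_nonempty V with hV | hV
  · simp [Finset.eq_empty_of_isEmpty, cutCard]
  have hd0' : (0 : ℝ) < d := by exact_mod_cast hd0
  have hlt : secondEigenvalue G < d := hd.trans_lt (by nlinarith)
  have h := (abs_le.1 (abs_cutCard_sub_le hG hlt S Sᶜ)).1
  have hTc : ((Sᶜ).card : ℝ) = Fintype.card V - S.card := by
    rw [Finset.card_compl, Nat.cast_sub (Finset.card_le_univ S)]
  rw [hTc] at h
  set n : ℝ := (Fintype.card V : ℝ) with hn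
  have hn0 : 0 < n := by
    rw [hn]; exact_mod_cast Fintype.card_pos
  set s : ℝ := (S.card : ℝ)
  have hs0 : 0 ≤ s := by positivity
  have hsn : s / n ≤ δ := by rwa [div_le_iff₀ hn0]
  have hsn0 : 0 ≤ s / n := by positivity
  have e1 : (s - s ^ 2 / n + (n - s - (n - s) ^ 2 / n)) / 2 = s * (1 - s / n) := by
    field_simp; ring
  have e2 : (d : ℝ) * s * (n - s) / n = d * s * (1 - s / n) := by
    field_simp
  rw [e1, e2] at h
  -- One factor `1 - δ` comes from the spectral gap and one from the size of `S`; then `(1 - δ) ^ 2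
  -- ≥ 1 - 2 * δ`.
  have hkey : (1 - 2 * δ) * d ≤ (d - secondEigenvalue G) * (1 - s / n) := by
    have h1 : d * (1 - δ) * (1 - δ) ≤ (d - secondEigenvalue G) * (1 - s / n) := by
      apply mul_le_mul <;> nlinarith
    nlinarith [sq_nonneg δ]
  nlinarith [mul_le_mul_of_nonneg_right hkey hs0]

/-- There are many edges between any two large sets. -/
lemma le_cutCard {d : ℕ} (hG : G.IsRegularOfDegree d) {δ : ℝ} (hδ : 0 ≤ δ)
    (hd : secondEigenvalue G < d) (hd' : secondEigenvalue G ≤ δ ^ 2 / 2 * d) {S T : Finset V}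
    (hS : δ * Fintype.card V ≤ S.card) (hT : δ * Fintype.card V ≤ T.card) :
    δ ^ 2 / 2 * d * Fintype.card V ≤ cutCard G.edgeFinset S T := by
  rcases isEmpty_or_nonempty V with hV | hV
  · simp [Finset.eq_empty_of_isEmpty, cutCard]
  have h := (abs_le.1 (abs_cutCard_sub_le hG hd S T)).1
  have hs := Finset.card_le_univ S
  have ht := Finset.card_le_univ T
  rw [← Nat.cast_le (α := ℝ)] at hs ht
  set n : ℝ := (Fintype.card V : ℝ) with hn
  have hn0 : 0 < n := by
    rw [hn]; exact_mod_cast Fintype.card_pos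
  set s : ℝ := (S.card : ℝ)
  set t : ℝ := (T.card : ℝ)
  have hs2 : 0 ≤ s ^ 2 / n := by positivity
  have ht2 : 0 ≤ t ^ 2 / n := by positivity
  have hsec : 0 ≤ secondEigenvalue G := Real.iSup_nonneg fun _ => abs_nonneg _
  have h1 : secondEigenvalue G * ((s - s ^ 2 / n + (t - t ^ 2 / n)) / 2) ≤
      secondEigenvalue G * n := by
    apply mul_le_mul_of_nonneg_left _ hsec; linarith
  have h2 : secondEigenvalue G * n ≤ δ ^ 2 / 2 * d * n := by gcongr
  have h3 : d * (δ * n) * (δ * n) / n ≤ d * s * t / n := by gcongr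
  have h4 : d * (δ * n) * (δ * n) / n = δ ^ 2 * d * n := by field_simp
  linarith

end Mixing

/-! ### Bounds on cluster sizes in a fixed graph -/

section FiniteBounds

variable {V : Type*} [Fintype V] [DecidableEq V]

lemma compl_singleton_sdiff_cluster (F : Finset (Sym2 V)) (v : V) :
    ({v}ᶜ : Finset V) \ cluster F v = (cluster F v)ᶜ := by
  ext y
  simp only [Finset.mem_sdiff, Finset.mem_compl, Finset.mem_singleton, and_iff_right_iff_imp]
  rintro h rfl
  exact h (mem_cluster_self F y)

/-- Exponential tail of the cluster size in a subcritical random subgraph. -/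
lemma bernoulliProb_cluster_large {p z f M : ℝ} {d : ℕ} (h0 : 0 ≤ p) (h1 : p ≤ 1) (hz : 0 ≤ z)
    (hf : 1 ≤ f) (hzf : z * (1 - p + p * f) ^ d ≤ f) (hM : 0 < M) {E : Finset (Sym2 V)}
    (hd : ∀ a, (neighborsIn E a Finset.univ).card ≤ d) (v : V) :
    bernoulliProb p E {F | M ≤ z ^ (cluster F v).card} ≤ f / M := by
  have h := bernoulliMean_reach_le (w := 1) (f := f) h0 h1 hz (by linarith) le_rfl (by nlinarith)
    (by rwa [mul_one, add_comm]) hd {v} {v}ᶜ disjoint_compl_right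
  simp only [one_pow, mul_one, Finset.card_singleton, pow_one] at h
  refine (bernoulliProb.markov h0 h1 (f := fun F => z ^ (cluster F v).card)
    (fun F _ => by positivity) hM fun F _ hF => hF).trans ?_
  gcongr
  exact h

/-- In a pseudo-random graph, a cluster is unlikely to have a size that is neither small nor
linear. -/
lemma bernoulliProb_cluster_medium {G : SimpleGraph V} [DecidableRel G.Adj] {d : ℕ}
    (hG : G.IsRegularOfDegree d) {δ α M : ℝ} (hδ1 : δ < 1)
    (hd : secondEigenvalue G ≤ δ * d) (hα : 1 < α) (hαd : α < d) (hM : 0 < M) (v : V) :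
    bernoulliProb (α / d) G.edgeFinset
      {F | ((cluster F v).card : ℝ) ≤ δ * Fintype.card V ∧
        M ≤ (Real.exp (α * (1 - 2 * δ) - 1) / α) ^ (cluster F v).card} ≤ 1 / M := by
  have hα0 : 0 < α := by linarith
  have hd0 : (0 : ℝ) < d := hα0.trans hαd
  have hdn : 0 < d := by exact_mod_cast hd0
  set p : ℝ := α / d with hp
  have h0 : 0 ≤ p := by positivity
  have h1 : p < 1 := by rw [hp, div_lt_one hd0]; exact hαd
  have hq : p * (1 / α) + (1 - p) * (1 - p)⁻¹ = 1 / d + 1 := by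
    rw [mul_inv_cancel₀ (by linarith), hp]
    field_simp
  have hw : Real.exp p ≤ (1 - p)⁻¹ := by
    rw [← inv_inv (Real.exp p), ← Real.exp_neg]
    refine inv_anti₀ (by linarith) ?_
    have := Real.add_one_le_exp (-p)
    linarith
  -- The weight `w = (1 - p)⁻¹` compensates the probability that a boundary edge is absent. An
  -- admissible `x` is asymptotically at most `f * exp (-(α * f))`, which is largest at `f = 1 / α`.
  have h := bernoulliMean_reach_le (x := Real.exp (-1) / α) (w := (1 - p)⁻¹) (f := 1 / α) (d := d)
    h0 h1.le (by positivity) (by positivity) ((Real.one_le_exp h0).trans hw)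
    (by rw [hq]; have : 0 < 1 / (d : ℝ) := by positivity
        linarith)
    (by
      rw [hq]
      have h2 : (1 / (d : ℝ) + 1) ^ d ≤ Real.exp 1 := by
        calc (1 / (d : ℝ) + 1) ^ d ≤ Real.exp (1 / d) ^ d := by
              gcongr; exact Real.add_one_le_exp _
          _ = Real.exp 1 := by rw [← Real.exp_nat_mul]; congr 1; field_simp
      calc Real.exp (-1) / α * (1 / (d : ℝ) + 1) ^ d ≤ Real.exp (-1) / α * Real.exp 1 := by gcongr
        _ = 1 / α := by rw [div_mul_eq_mul_div, ← Real.exp_add]; simp)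
    (fun a => (card_neighborsIn_edgeFinset hG a).le) {v} {v}ᶜ disjoint_compl_right
  rw [Finset.card_singleton, pow_one] at h
  have hα1 : 1 / α ≤ 1 := by rw [div_le_one hα0]; exact hα.le
  have hw0 : 0 ≤ (1 - p)⁻¹ := inv_nonneg.2 (by linarith)
  refine (bernoulliProb.markov h0 h1.le (fun F _ => by positivity) hM fun F _ hF => ?_).trans
    (div_le_div_of_nonneg_right (h.trans hα1) hM.le)
  obtain ⟨hs, hMr⟩ := hF
  refine hMr.trans ?_
  change _ ≤ (Real.exp (-1) / α) ^ (cluster F v).card *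
    (1 - p)⁻¹ ^ cutCard G.edgeFinset (cluster F v) ({v}ᶜ \ cluster F v)
  rw [compl_singleton_sdiff_cluster]
  set k := (cluster F v).card with hk
  have hcut := le_cutCard_compl hG hdn hδ1 hd hs
  calc (Real.exp (α * (1 - 2 * δ) - 1) / α) ^ k
      = (Real.exp (-1) / α) ^ k * Real.exp (p * ((1 - 2 * δ) * d * k)) := by
        have e1 : p * ((1 - 2 * δ) * d * k) = k * (α * (1 - 2 * δ)) := by
          rw [hp]; field_simp
        rw [e1, Real.exp_nat_mul, ← mul_pow, div_mul_eq_mul_div, ← Real.exp_add]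
        congr 3; ring
    _ ≤ (Real.exp (-1) / α) ^ k *
        Real.exp (p * cutCard G.edgeFinset (cluster F v) (cluster F v)ᶜ) := by gcongr
    _ = (Real.exp (-1) / α) ^ k *
        Real.exp p ^ cutCard G.edgeFinset (cluster F v) (cluster F v)ᶜ := by
        rw [mul_comm p, Real.exp_nat_mul]
    _ ≤ _ := by gcongr

/-- The number of vertices in clusters of size at most `s`. -/
noncomputable def smallCount (s : ℝ) (F : Finset (Sym2 V)) : ℕ :=
  (Finset.univ.filter fun v => ((cluster F v).card : ℝ) ≤ s).card

section Regular

variable {E : Finset (Sym2 V)} {d : ℕ} {p y : ℝ} {K : ℕ}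

/-- A joint exploration from `v` and `w` stays inside the two clusters, so it reaches at most `2 *
K` vertices. Its two starting points yield `y ^ 2`, without conditioning one cluster on the other.
-/
lemma bernoulliProb_cluster_pair_le (hE : ∀ a, (neighborsIn E a Finset.univ).card = d)
    (h0 : 0 ≤ p) (h1 : p ≤ 1) (hy : 0 ≤ y) (hy1 : y ≤ 1)
    (hyd : (1 - p + p * y) ^ (d - 2 * K) ≤ y) {v w : V} (hvw : v ≠ w) :
    bernoulliProb p E {F | ((cluster F v).card : ℝ) ≤ (K : ℝ) ∧
      ((cluster F w).card : ℝ) ≤ (K : ℝ)} ≤ y ^ 2 := by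
  have h := bernoulliProb_reach_le h0 h1 hy hy1 hyd hE (2 * K) {v, w} {v, w}ᶜ
    disjoint_compl_right (by rw [compl_compl]; omega)
  rw [Finset.card_pair hvw] at h
  refine (bernoulliProb.mono h0 h1 fun F _ hF => ?_).trans h
  simp only [Set.mem_ofPred_eq, Nat.cast_le] at hF ⊢
  have h2 := Finset.card_le_card (reach_pair_subset F v w {v, w}ᶜ)
  have h3 := Finset.card_union_le (cluster F v) (cluster F w)
  omega

lemma le_bernoulliProb_cluster {y₀ g t : ℝ} (hE : ∀ a, (neighborsIn E a Finset.univ).card = d)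
    (h0 : 0 ≤ p) (h1 : p ≤ 1) (hy : 0 ≤ y₀)
    (hy1 : y₀ ≤ 1) (hg : 0 ≤ g) (hg1 : g ≤ 1) (ht : 0 ≤ t) (ht1 : t ≤ 1) (hygt : y₀ ≤ g * t)
    (hyd : y₀ ≤ (1 - p + p * y₀) ^ d) (hgd : (1 - p + p * g) ^ (d - 2 * K) ≤ t * g) (v : V) :
    y₀ - t ^ K ≤ bernoulliProb p E {F | ((cluster F v).card : ℝ) ≤ (K : ℝ)} := by
  have h := le_bernoulliProb_reach h0 h1 hy hy1 hg hg1 ht ht1 hygt hyd hgd hE K {v} {v}ᶜ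
    disjoint_compl_right (by simp; omega)
  simp only [Finset.card_singleton, pow_one] at h
  have h2 : g * t ^ K ≤ t ^ K := mul_le_of_le_one_left (by positivity) hg1
  have h3 : y₀ - t ^ K ≤ y₀ - g * t ^ K := by linarith
  simpa only [Nat.cast_le, cluster] using h3.trans h

/-- Concentration of the number of vertices in clusters of bounded size, by Chebyshev's
inequality. -/
lemma bernoulliProb_smallCount {y₀ g t ε : ℝ}
    (hE : ∀ a, (neighborsIn E a Finset.univ).card = d)
    (h0 : 0 ≤ p) (h1 : p ≤ 1) (hy : 0 ≤ y) (hy1 : y ≤ 1)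
    (hyd : (1 - p + p * y) ^ (d - 2 * K) ≤ y) (hy0 : 0 ≤ y₀)
    (hy01 : y₀ ≤ y) (hg : 0 ≤ g) (hg1 : g ≤ 1) (ht : 0 ≤ t) (ht1 : t ≤ 1) (hygt : y₀ ≤ g * t)
    (hy0d : y₀ ≤ (1 - p + p * y₀) ^ d) (hgd : (1 - p + p * g) ^ (d - 2 * K) ≤ t * g)
    (hε : 0 < ε) (hn : 0 < Fintype.card V) :
    bernoulliProb p E {F | ε * Fintype.card V ≤ |(smallCount K F : ℝ) - y * Fintype.card V|} ≤
      (2 * (y - y₀ + t ^ K) + 1 / Fintype.card V) / ε ^ 2 := by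
  classical
  set n : ℝ := (Fintype.card V : ℝ) with hn'
  have hn0 : 0 < n := by rw [hn']; exact_mod_cast hn
  have hmean : n * (y₀ - t ^ K) ≤ bernoulliMean p E (fun F => (smallCount K F : ℝ)) := by
    have := bernoulliProb.mean_card_filter p E (Finset.univ : Finset V)
      (fun v => {F | ((cluster F v).card : ℝ) ≤ (K : ℝ)})
    have h2 : bernoulliMean p E (fun F => (smallCount K F : ℝ)) =
        ∑ v : V, bernoulliProb p E {F | ((cluster F v).card : ℝ) ≤ (K : ℝ)} := by
      rw [← this]; rfl
    rw [h2]
    calc n * (y₀ - t ^ K) = ∑ _v : V, (y₀ - t ^ K) := by simp [hn', mul_sub]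
      _ ≤ _ := Finset.sum_le_sum fun v _ =>
        le_bernoulliProb_cluster hE h0 h1 hy0 (hy01.trans hy1) hg hg1 ht ht1 hygt hy0d hgd v
  have hsq : bernoulliMean p E (fun F => (smallCount K F : ℝ) ^ 2) ≤ n ^ 2 * y ^ 2 + n := by
    have h2 : bernoulliMean p E (fun F => (smallCount K F : ℝ) ^ 2) =
        ∑ x : V × V, bernoulliProb p E {F | ((cluster F x.1).card : ℝ) ≤ (K : ℝ) ∧
          ((cluster F x.2).card : ℝ) ≤ (K : ℝ)} := by
      rw [← bernoulliProb.mean_card_filter]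
      refine bernoulliMean.congr fun F _ => ?_
      rw [sq, ← Nat.cast_mul, smallCount, ← Finset.card_product, ← Finset.filter_product]
      rfl
    have h3 : ∀ x : V × V, bernoulliProb p E {F | ((cluster F x.1).card : ℝ) ≤ (K : ℝ) ∧
          ((cluster F x.2).card : ℝ) ≤ (K : ℝ)} ≤ y ^ 2 + if x.1 = x.2 then 1 else 0 := by
      rintro ⟨v, w⟩
      by_cases hvw : v = w
      · rw [if_pos hvw]
        have := bernoulliProb.le_one (E := E) (S := {F | ((cluster F v).card : ℝ) ≤ (K : ℝ) ∧
          ((cluster F w).card : ℝ) ≤ (K : ℝ)}) h0 h1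
        nlinarith [sq_nonneg y]
      · rw [if_neg hvw, add_zero]
        exact bernoulliProb_cluster_pair_le hE h0 h1 hy hy1 hyd hvw
    rw [h2]
    refine (Finset.sum_le_sum fun x _ => h3 x).trans (le_of_eq ?_)
    rw [Finset.sum_add_distrib, Fintype.sum_prod_type, Fintype.sum_prod_type]
    simp [hn']
    ring
  -- The second moment is taken about `y * n` rather than the mean: an upper bound on the square and
  -- a lower bound on the mean suffice, at the cost of the gap between `y` and `y₀`.
  have hvar : bernoulliMean p E (fun F => ((smallCount K F : ℝ) - y * n) ^ 2) ≤
      n ^ 2 * (2 * (y - y₀ + t ^ K)) + n := by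
    have e : bernoulliMean p E (fun F => ((smallCount K F : ℝ) - y * n) ^ 2) =
        bernoulliMean p E (fun F => (smallCount K F : ℝ) ^ 2) -
          2 * y * n * bernoulliMean p E (fun F => (smallCount K F : ℝ)) + (y * n) ^ 2 := by
      rw [← bernoulliMean.const_mul, ← bernoulliMean.sub,
        ← bernoulliMean.const p ((y * n) ^ 2) E, ← bernoulliMean.add]
      exact bernoulliMean.congr fun F _ => by ring
    rw [e]
    have h4 := mul_le_mul_of_nonneg_left hmean (by positivity : 0 ≤ 2 * y * n)
    have ht0 : 0 ≤ t ^ K := by positivity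
    have h5 : 2 * n ^ 2 * (y * (y - y₀ + t ^ K)) ≤ 2 * n ^ 2 * (y - y₀ + t ^ K) := by
      gcongr
      exact mul_le_of_le_one_left (by linarith) hy1
    nlinarith
  have hM := bernoulliProb.markov h0 h1 (E := E)
    (S := {F | ε * n ≤ |(smallCount K F : ℝ) - y * n|})
    (f := fun F => ((smallCount K F : ℝ) - y * n) ^ 2) (c := (ε * n) ^ 2)
    (fun F _ => sq_nonneg _) (by positivity) (fun F _ hF => by
      rw [← sq_abs ((smallCount K F : ℝ) - y * n)]
      have : ε * n ≤ |(smallCount K F : ℝ) - y * n| := hF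
      gcongr)
  refine hM.trans ((div_le_div_of_nonneg_right hvar (by positivity)).trans (le_of_eq ?_))
  field_simp

end Regular

lemma bernoulliProb_disjoint {ι : Type*} [DecidableEq ι] (p : ℝ) {E D : Finset ι} (hD : D ⊆ E) :
    bernoulliProb p E {F | Disjoint F D} = (1 - p) ^ D.card := by
  have hE : E = (E \ D) ∪ D := (Finset.sdiff_union_of_subset hD).symm
  rw [bernoulliProb]
  conv_lhs => rw [hE]
  rw [bernoulliMean.union Finset.sdiff_disjoint, ← bernoulliMean.const p ((1 - p) ^ D.card) (E \ D)]
  refine bernoulliMean.congr fun F₁ hF₁ => ?_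
  -- Since `0 ^ 0 = 1`, the function `0 ^ F₂.card` is the indicator of `F₂ = ∅`.
  have h0 := bernoulliMean.pow_card p 0 D
  rw [mul_zero, add_zero] at h0
  rw [← h0]
  refine bernoulliMean.congr fun F₂ hF₂ => ?_
  have h1 : Disjoint F₁ D := Finset.disjoint_of_subset_left hF₁ Finset.sdiff_disjoint
  have h2 : Disjoint (F₁ ∪ F₂) D ↔ F₂ = ∅ := by
    rw [Finset.disjoint_union_left]
    constructor
    · exact fun h => Finset.disjoint_self_iff_empty _ |>.1 (h.2.mono_right hF₂)
    · rintro rfl; exact ⟨h1, Finset.disjoint_empty_left _⟩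
  by_cases h : F₂ = ∅
  · simp [h, h1]
  · simp [Set.indicator, h2, h]

/-- The probability that no edge between two disjoint sets is present. -/
lemma bernoulliProb_no_edge_le {V : Type*} [DecidableEq V] {p : ℝ} (h0 : 0 ≤ p) (h1 : p ≤ 1) (E : Finset (Sym2 V))
    {S T : Finset V} (hST : Disjoint S T) :
    bernoulliProb p E {F | ∀ a ∈ S, ∀ b ∈ T, s(a, b) ∉ F} ≤ (1 - p) ^ cutCard E S T := by
  set P := (S ×ˢ T).filter fun x => s(x.1, x.2) ∈ E with hP
  set D := P.image fun x => s(x.1, x.2) with hD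
  have hcard : D.card = cutCard E S T := by
    rw [hD, Finset.card_image_of_injOn, hP, Finset.card_filter, Finset.sum_product, cutCard]
    · exact Finset.sum_congr rfl fun a _ => (Finset.card_filter _ _).symm
    · rintro ⟨a, b⟩ hab ⟨a', b'⟩ hab' h
      simp only [hP, Finset.coe_filter, Finset.mem_product, Set.mem_ofPred_eq] at hab hab'
      rcases Sym2.eq_iff.1 h with ⟨h1, h2⟩ | ⟨h1, h2⟩
      · exact Prod.ext h1 h2
      · exact absurd hab'.1.2 (Finset.disjoint_left.1 hST (show b' ∈ S from (show a = b' from h1) ▸ hab.1.1))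
  have hDE : D ⊆ E := by
    intro e he
    obtain ⟨x, hx, rfl⟩ := Finset.mem_image.1 he
    exact (Finset.mem_filter.1 hx).2
  rw [← hcard, ← bernoulliProb_disjoint p hDE]
  refine bernoulliProb.mono h0 h1 fun F _ hF => ?_
  refine Finset.disjoint_right.2 fun e he => ?_
  obtain ⟨x, hx, rfl⟩ := Finset.mem_image.1 he
  have := Finset.mem_product.1 (Finset.mem_filter.1 hx).1
  exact hF _ this.1 _ this.2

/-- After sprinkling, two large clusters are likely to be in the same cluster. -/
lemma bernoulliProb_not_connected_le {G : SimpleGraph V} [DecidableRel G.Adj] {d : ℕ}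
    (hG : G.IsRegularOfDegree d) {δ p β : ℝ} (hδ : 0 ≤ δ) (h0 : 0 ≤ p) (h1 : p ≤ 1)
    (hβ : 0 ≤ β) (hpβ : 1 - p ≤ Real.exp (-(β / d))) (hd0 : 0 < d)
    (hd : secondEigenvalue G < d) (hd' : secondEigenvalue G ≤ δ ^ 2 / 2 * d)
    (F₁ : Finset (Sym2 V)) (v w : V)
    (hv : δ * Fintype.card V ≤ (cluster F₁ v).card)
    (hw : δ * Fintype.card V ≤ (cluster F₁ w).card) :
    bernoulliProb p G.edgeFinset {F₂ | w ∉ cluster (F₁ ∪ F₂) v} ≤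
      Real.exp (-(β * (δ ^ 2 / 2) * Fintype.card V)) := by
  by_cases hvw : w ∈ cluster F₁ v
  · have : bernoulliProb p G.edgeFinset {F₂ | w ∉ cluster (F₁ ∪ F₂) v} ≤
        bernoulliProb p G.edgeFinset ∅ := bernoulliProb.mono h0 h1 fun F₂ _ hF =>
          absurd (cluster_mono Finset.subset_union_left v hvw) hF
    refine this.trans ?_
    rw [bernoulliProb, Set.indicator_empty, bernoulliMean.const]
    exact (Real.exp_pos _).le
  have hdisj := disjoint_cluster hvw
  have hcut := le_cutCard hG hδ hd hd' hv hw
  calc _ ≤ bernoulliProb p G.edgeFinset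
        {F | ∀ a ∈ cluster F₁ v, ∀ b ∈ cluster F₁ w, s(a, b) ∉ F} := by
        refine bernoulliProb.mono h0 h1 fun F₂ _ hF a ha b hb hab => hF ?_
        have ha' := cluster_mono (Finset.subset_union_left (s₂ := F₂)) v ha
        have hb' := cluster_mono (Finset.subset_union_left (s₂ := F₂)) w hb
        have := mem_cluster_of_edge ha' (Finset.mem_union_right _ hab)
        rw [← cluster_eq_of_mem this, cluster_eq_of_mem hb']
        exact mem_cluster_self _ _
    _ ≤ (1 - p) ^ cutCard G.edgeFinset (cluster F₁ v) (cluster F₁ w) :=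
        bernoulliProb_no_edge_le h0 h1 _ hdisj
    _ ≤ Real.exp (-(β / d)) ^ cutCard G.edgeFinset (cluster F₁ v) (cluster F₁ w) := by
        gcongr
    _ = Real.exp (-(β / d * cutCard G.edgeFinset (cluster F₁ v) (cluster F₁ w))) := by
        rw [← Real.exp_nat_mul]; congr 1; ring
    _ ≤ _ := by
        have hd0' : (0 : ℝ) < d := by exact_mod_cast hd0
        refine Real.exp_le_exp.2 (neg_le_neg ?_)
        calc β * (δ ^ 2 / 2) * Fintype.card V = β / d * (δ ^ 2 / 2 * d * Fintype.card V) := by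
              field_simp
          _ ≤ _ := by gcongr

end FiniteBounds

/-! ### The dual parameter and the extinction probability -/

section Duality

/-- The inequality `u + 1 < exp u` at `u = x - y` replaces a derivative; for `0 < y` it leaves the
sign of `(y - x) * (1 - y)`. -/
lemma mul_exp_neg_strictMonoOn : StrictMonoOn (fun x : ℝ => x * Real.exp (-x)) (Set.Iic 1) := by
  intro x _ y hy hxy
  have hy1 : y ≤ 1 := hy
  have key : x < y * Real.exp (x - y) := by
    rcases le_or_gt y 0 with h | h
    · have : Real.exp (x - y) ≤ 1 := Real.exp_le_one_iff.2 (by linarith)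
      nlinarith
    · have := Real.add_one_lt_exp (x := x - y) (by linarith)
      nlinarith
  have e : y * Real.exp (-y) = y * Real.exp (x - y) * Real.exp (-x) := by
    rw [mul_assoc, ← Real.exp_add]; congr 2; ring
  simp only [e]
  exact mul_lt_mul_of_pos_right key (Real.exp_pos _)

lemma mul_exp_neg_strictAntiOn : StrictAntiOn (fun x : ℝ => x * Real.exp (-x)) (Set.Ici 1) := by
  intro x hx y _ hxy
  have hx1 : 1 ≤ x := hx
  have key : y < x * Real.exp (y - x) := by
    have := Real.add_one_lt_exp (x := y - x) (by linarith)
    nlinarith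
  have e : x * Real.exp (-x) = x * Real.exp (y - x) * Real.exp (-y) := by
    rw [mul_assoc, ← Real.exp_add]; congr 2; ring
  simp only [e]
  exact mul_lt_mul_of_pos_right key (Real.exp_pos _)

/-- The dual parameter of a supercritical parameter. -/
lemma exists_dual {α : ℝ} (hα : 1 < α) :
    ∃ β : ℝ, 0 < β ∧ β < 1 ∧
      (∀ x, x < β → x * Real.exp (-x) < α * Real.exp (-α)) ∧
      (∀ x, β < x → x < α → α * Real.exp (-α) < x * Real.exp (-x)) ∧
      ∀ x : ℝ, x * Real.exp (-x) = α * Real.exp (-α) ↔ x = β ∨ x = α := by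
  have hα0 : 0 < α * Real.exp (-α) := mul_pos (by linarith) (Real.exp_pos _)
  have hα1 : α * Real.exp (-α) < 1 * Real.exp (-1) :=
    mul_exp_neg_strictAntiOn Set.self_mem_Ici (Set.mem_Ici.2 hα.le) hα
  obtain ⟨β, ⟨hβ0, hβ1⟩, hβ⟩ := intermediate_value_Ioo (zero_le_one' ℝ)
    (f := fun x : ℝ => x * Real.exp (-x)) (by fun_prop)
    (show α * Real.exp (-α) ∈ Set.Ioo _ _ from ⟨by simpa using hα0, hα1⟩)
  have hβ' : β * Real.exp (-β) = α * Real.exp (-α) := hβ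
  have hlow : ∀ x, x < β → x * Real.exp (-x) < α * Real.exp (-α) := fun x hx => by
    rw [← hβ']
    exact mul_exp_neg_strictMonoOn (Set.mem_Iic.2 (by linarith)) (Set.mem_Iic.2 hβ1.le) hx
  have hmid : ∀ x, β < x → x < α → α * Real.exp (-α) < x * Real.exp (-x) := fun x hx hxα => by
    rcases le_total x 1 with h | h
    · rw [← hβ']
      exact mul_exp_neg_strictMonoOn (Set.mem_Iic.2 hβ1.le) (Set.mem_Iic.2 h) hx
    · exact mul_exp_neg_strictAntiOn (Set.mem_Ici.2 h) (Set.mem_Ici.2 hα.le) hxα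
  refine ⟨β, hβ0, hβ1, hlow, hmid, fun x => ⟨fun h => ?_, ?_⟩⟩
  · by_contra! hne
    rcases lt_or_gt_of_ne hne.1 with h1 | h1
    · exact (hlow x h1).ne h
    rcases lt_or_gt_of_ne hne.2 with h2 | h2
    · exact (hmid x h1 h2).ne' h
    · exact (mul_exp_neg_strictAntiOn (Set.mem_Ici.2 hα.le) (Set.mem_Ici.2 (by linarith)) h2).ne h
  · rintro (rfl | rfl)
    exacts [hβ', rfl]

/-- The substitution `x = α * y` turns the fixed-point inequality for the extinction probability
into a comparison of values of `x * exp (-x)`. For `1 < α` the fixed points are therefore 1 and the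
dual parameter divided by `α`. -/
lemma exp_lt_iff_mul_exp_neg {α y : ℝ} (hα : 0 < α) :
    Real.exp (-(α * (1 - y))) < y ↔ α * Real.exp (-α) < (α * y) * Real.exp (-(α * y)) := by
  have e : α * Real.exp (-α) = α * Real.exp (-(α * (1 - y))) * Real.exp (-(α * y)) := by
    rw [mul_assoc, ← Real.exp_add]; congr 2; ring
  rw [e, mul_lt_mul_iff_left₀ (Real.exp_pos _), mul_lt_mul_iff_right₀ hα]

lemma lt_exp_iff_mul_exp_neg {α y : ℝ} (hα : 0 < α) :
    y < Real.exp (-(α * (1 - y))) ↔ (α * y) * Real.exp (-(α * y)) < α * Real.exp (-α) := by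
  have e : α * Real.exp (-α) = α * Real.exp (-(α * (1 - y))) * Real.exp (-(α * y)) := by
    rw [mul_assoc, ← Real.exp_add]; congr 2; ring
  rw [e, mul_lt_mul_iff_left₀ (Real.exp_pos _), mul_lt_mul_iff_right₀ hα]

end Duality

/-- Generating functions of binomial offspring converge to that of Poisson(`α`); losing a bounded
number `k` of possible children does not affect the limit. -/
lemma tendsto_one_sub_add_pow (α y : ℝ) (k : ℕ) :
    Tendsto (fun m : ℕ => (1 - α / m + α / m * y) ^ (m - k)) atTop
      (𝓝 (Real.exp (-(α * (1 - y))))) := by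
  set c := -(α * (1 - y)) with hc
  have h0 : Tendsto (fun m : ℕ => 1 + c / (m : ℝ)) atTop (𝓝 1) := by
    simpa using (tendsto_const_nhds (x := (1 : ℝ))).add
      (tendsto_const_nhds (x := c) |>.div_atTop tendsto_natCast_atTop_atTop)
  have h1 := (Real.tendsto_one_add_div_pow_exp c).div (h0.pow k) (by simp)
  rw [one_pow, div_one] at h1
  refine h1.congr' ?_
  filter_upwards [eventually_ge_atTop k, h0.eventually_ne one_ne_zero] with m hm hne
  have e : 1 - α / m + α / m * y = 1 + c / (m : ℝ) := by rw [hc]; ring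
  rw [e, pow_sub₀ _ hne hm]
  rfl

/-! ### Asymptotic bounds along a pseudo-random sequence -/

namespace IsPseudoRandomSeq

variable {n d : ℕ → ℕ} {G : (i : ℕ) → SimpleGraph (Fin (n i))} [∀ i, DecidableRel (G i).Adj]

lemma tendsto_card_real (h : IsPseudoRandomSeq n d G) :
    Tendsto (fun i => (n i : ℝ)) atTop atTop :=
  tendsto_natCast_atTop_atTop.comp h.tendsto_card

lemma eventually_lt_degree (h : IsPseudoRandomSeq n d G) (α : ℝ) :
    ∀ᶠ i in atTop, α < d i :=
  (tendsto_natCast_atTop_atTop.comp h.tendsto_degree).eventually_gt_atTop α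

lemma eventually_secondEigenvalue_le (h : IsPseudoRandomSeq n d G) {c : ℝ} (hc : 0 < c) :
    ∀ᶠ i in atTop, secondEigenvalue (G i) ≤ c * d i := by
  filter_upwards [h.eigenvalue_isLittleO.bound hc] with i hi
  simpa using (le_abs_self _).trans hi

lemma edgeProb_eq {α : ℝ} (hα : 0 ≤ α) {d : ℕ} (hd : α < d) : (edgeProb α d : ℝ) = α / d := by
  have hd0 : (0 : ℝ) < d := hα.trans_lt hd
  rw [edgeProb, Set.projIcc_of_mem zero_le_one ⟨by positivity, (div_le_one hd0).2 hd.le⟩]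

/-- Convergence in probability, in terms of finite sums. -/
lemma tendsto_randomSubgraph (h : IsPseudoRandomSeq n d G) {α : ℝ} (hα : 0 ≤ α)
    (S : ∀ i, Set (SimpleGraph (Fin (n i))))
    (hS : ∀ κ > 0, ∀ᶠ i in atTop, bernoulliProb (α / d i) (G i).edgeFinset
      {F | SimpleGraph.fromEdgeSet (F : Set (Sym2 (Fin (n i)))) ∉ S i} ≤ κ) :
    Tendsto (fun i => (randomSubgraph (G i) (edgeProb α (d i))).real (S i)) atTop (𝓝 1) := by
  rw [Metric.tendsto_atTop']
  intro κ hκ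
  obtain ⟨N, hN⟩ := ((hS (κ / 2) (by positivity)).and
    (h.eventually_lt_degree α)).exists_forall_of_atTop
  refine ⟨N, fun i hi => ?_⟩
  obtain ⟨h1, h2⟩ := hN i hi.le
  have hd0 : (0 : ℝ) < d i := hα.trans_lt h2
  rw [randomSubgraph_real, edgeProb_eq hα h2]
  have hc := bernoulliProb.compl (α / d i) (G i).edgeFinset
    {F | SimpleGraph.fromEdgeSet (F : Set (Sym2 (Fin (n i)))) ∈ S i}
  have hle := bernoulliProb.le_one (p := α / d i) (E := (G i).edgeFinset)
    (S := {F | SimpleGraph.fromEdgeSet (F : Set (Sym2 (Fin (n i)))) ∈ S i})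
    (by positivity) ((div_le_one hd0).2 h2.le)
  have hc' : bernoulliProb (α / d i) (G i).edgeFinset
      {F | SimpleGraph.fromEdgeSet (F : Set (Sym2 (Fin (n i)))) ∉ S i} =
      1 - bernoulliProb (α / d i) (G i).edgeFinset
    {F | SimpleGraph.fromEdgeSet (F : Set (Sym2 (Fin (n i)))) ∈ S i} := hc
  rw [Real.dist_eq, abs_lt]
  constructor <;> linarith

/-- In the subcritical case all clusters have logarithmic size. -/
lemma eventually_subcritical (h : IsPseudoRandomSeq n d G) {α z f : ℝ} (hα : 0 ≤ α)
    (hf : 1 ≤ f) (hz : 1 < z) (hzf : z * Real.exp (α * (f - 1)) ≤ f) {κ : ℝ} (hκ : 0 < κ) :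
    ∀ᶠ i in atTop, bernoulliProb (α / d i) (G i).edgeFinset
      {F | ∃ v, (n i : ℝ) ^ 2 ≤ z ^ (cluster F v).card} ≤ κ := by
  have hlim : Tendsto (fun i => f / (n i : ℝ)) atTop (𝓝 0) :=
    tendsto_const_nhds.div_atTop h.tendsto_card_real
  filter_upwards [h.eventually_lt_degree α, hlim.eventually_le_const hκ,
    h.tendsto_card_real.eventually_gt_atTop 0] with i hd hκi hn
  have hd0 : (0 : ℝ) < d i := hα.trans_lt hd
  have h0 : 0 ≤ α / d i := by positivity
  have h1 : α / d i ≤ 1 := (div_le_one hd0).2 hd.le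
  have hpow : z * (1 - α / d i + α / d i * f) ^ d i ≤ f := by
    refine le_trans ?_ hzf
    have e : Real.exp (α * (f - 1)) = Real.exp (α / d i * (f - 1)) ^ d i := by
      rw [← Real.exp_nat_mul]; congr 1; field_simp
    rw [e]
    have hb : 1 - α / d i + α / d i * f = α / d i * (f - 1) + 1 := by ring
    have hb0 : 0 ≤ α / d i * (f - 1) + 1 := by
      have := mul_nonneg h0 (sub_nonneg.2 hf); linarith
    rw [hb]
    gcongr
    exact Real.add_one_le_exp _
  calc _ ≤ ∑ v : Fin (n i), bernoulliProb (α / d i) (G i).edgeFinset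
        {F | (n i : ℝ) ^ 2 ≤ z ^ (cluster F v).card} :=
        bernoulliProb.le_sum h0 h1 _ fun F _ hF => by
          obtain ⟨v, hv⟩ := hF
          exact ⟨v, Finset.mem_univ v, hv⟩
    -- The threshold `n ^ 2` beats the `n` terms of the union bound.
    _ ≤ ∑ _v : Fin (n i), f / (n i : ℝ) ^ 2 := Finset.sum_le_sum fun v _ =>
        bernoulliProb_cluster_large h0 h1 (by linarith) hf hpow (by positivity)
          (fun a => (card_neighborsIn_edgeFinset (h.regular i) a).le) v
    _ = f / n i := by
        simp only [Finset.sum_const, Finset.card_univ, Fintype.card_fin, nsmul_eq_mul]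
        field_simp
    _ ≤ κ := hκi

/-- In the supercritical case there are no clusters of an intermediate size. -/
lemma eventually_no_medium (h : IsPseudoRandomSeq n d G) {α δ : ℝ} (hα : 1 < α) (hδ : 0 < δ)
    (hδ1 : δ < 1) {κ : ℝ} (hκ : 0 < κ) :
    ∀ᶠ i in atTop, bernoulliProb (α / d i) (G i).edgeFinset
      {F | ∃ v, ((cluster F v).card : ℝ) ≤ δ * n i ∧
        (n i : ℝ) ^ 2 ≤ (Real.exp (α * (1 - 2 * δ) - 1) / α) ^ (cluster F v).card} ≤ κ := by
  have hlim : Tendsto (fun i => 1 / (n i : ℝ)) atTop (𝓝 0) :=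
    tendsto_const_nhds.div_atTop h.tendsto_card_real
  filter_upwards [h.eventually_lt_degree α, hlim.eventually_le_const hκ,
    h.tendsto_card_real.eventually_gt_atTop 0, h.eventually_secondEigenvalue_le hδ]
    with i hd hκi hn hsec
  have hα0 : 0 < α := by linarith
  have hd0 : (0 : ℝ) < d i := hα0.trans hd
  have h0 : 0 ≤ α / d i := by positivity
  have h1 : α / d i ≤ 1 := (div_le_one hd0).2 hd.le
  have hv := bernoulliProb_cluster_medium (h.regular i) hδ1 hsec hα hd
    (by positivity : 0 < (n i : ℝ) ^ 2)
  rw [Fintype.card_fin] at hv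
  calc _ ≤ ∑ v : Fin (n i), bernoulliProb (α / d i) (G i).edgeFinset
        {F | ((cluster F v).card : ℝ) ≤ δ * n i ∧
        (n i : ℝ) ^ 2 ≤ (Real.exp (α * (1 - 2 * δ) - 1) / α) ^ (cluster F v).card} :=
        bernoulliProb.le_sum h0 h1 _ fun F _ hF => by
          obtain ⟨v, hv⟩ := hF
          exact ⟨v, Finset.mem_univ v, hv⟩
    _ ≤ ∑ _v : Fin (n i), 1 / (n i : ℝ) ^ 2 := Finset.sum_le_sum fun v _ => hv v
    _ = 1 / n i := by
        simp only [Finset.sum_const, Finset.card_univ, Fintype.card_fin, nsmul_eq_mul]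
        field_simp
    _ ≤ κ := hκi

/-- The number of vertices in clusters of bounded size. -/
lemma eventually_smallCount (h : IsPseudoRandomSeq n d G) {α y y₀ g t ε : ℝ} (hα : 0 ≤ α)
    (hy0 : 0 ≤ y₀) (hy01 : y₀ ≤ y) (hy1 : y ≤ 1) (hg : 0 ≤ g) (hg1 : g ≤ 1) (ht : 0 ≤ t)
    (ht1 : t ≤ 1) (hygt : y₀ ≤ g * t) (hy : Real.exp (-(α * (1 - y))) < y)
    (hy0' : y₀ < Real.exp (-(α * (1 - y₀)))) (hg' : Real.exp (-(α * (1 - g))) < t * g)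
    (hε : 0 < ε) (K : ℕ) :
    ∀ᶠ i in atTop, bernoulliProb (α / d i) (G i).edgeFinset
      {F | ε * n i ≤ |(smallCount K F : ℝ) - y * n i|} ≤
        (2 * (y - y₀ + t ^ K) + 1 / n i) / ε ^ 2 := by
  have e1 := ((tendsto_one_sub_add_pow α y (2 * K)).comp h.tendsto_degree).eventually_le_const hy
  have e2 := ((tendsto_one_sub_add_pow α y₀ 0).comp h.tendsto_degree).eventually_const_le hy0'
  have e3 := ((tendsto_one_sub_add_pow α g (2 * K)).comp h.tendsto_degree).eventually_le_const hg'
  filter_upwards [e1, e2, e3, h.eventually_lt_degree α, h.tendsto_card.eventually_gt_atTop 0]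
    with i h1 h2 h3 hd hn
  have hd0 : (0 : ℝ) < d i := hα.trans_lt hd
  have := bernoulliProb_smallCount (V := Fin (n i)) (card_neighborsIn_edgeFinset (h.regular i))
    (p := α / d i) (by positivity) ((div_le_one hd0).2 hd.le) (hy0.trans hy01) hy1 h1 hy0 hy01
    hg hg1 ht ht1 hygt h2 h3 hε (by simpa using hn)
  simpa only [Fintype.card_fin] using this

/-- The number of vertices in clusters that are not of linear size. -/
lemma eventually_smallCount_linear (h : IsPseudoRandomSeq n d G) {α y y₀ g t ε δ κ : ℝ}
    (hα : 1 < α) (hy0 : 0 ≤ y₀) (hy01 : y₀ ≤ y) (hy1 : y ≤ 1) (hg : 0 ≤ g) (hg1 : g ≤ 1)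
    (ht : 0 ≤ t) (ht1 : t < 1) (hygt : y₀ ≤ g * t) (hy : Real.exp (-(α * (1 - y))) < y)
    (hy0' : y₀ < Real.exp (-(α * (1 - y₀)))) (hg' : Real.exp (-(α * (1 - g))) < t * g)
    (hε : 0 < ε) (hδ : 0 < δ) (hδ1 : δ < 1) (hr : 1 < Real.exp (α * (1 - 2 * δ) - 1) / α)
    (hκ : 2 * (y - y₀) / ε ^ 2 < κ) :
    ∀ᶠ i in atTop, bernoulliProb (α / d i) (G i).edgeFinset
      {F | 2 * ε * n i ≤ |(smallCount (δ * n i) F : ℝ) - y * n i|} ≤ κ := by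
  classical
  set r := Real.exp (α * (1 - 2 * δ) - 1) / α with hr'
  -- Only `2 * (y - y₀) / ε ^ 2` survives as `K` grows, and `hκ` leaves room for the rest. Thus `K`
  -- is a constant, chosen before `i`.
  have hK : ∃ K : ℕ, 2 * (y - y₀ + t ^ K) / ε ^ 2 + r⁻¹ ^ K / ε < κ := by
    have h1 := tendsto_pow_atTop_nhds_zero_of_lt_one ht ht1
    have h2 := tendsto_pow_atTop_nhds_zero_of_lt_one (inv_nonneg.2 (by linarith : 0 ≤ r))
      (inv_lt_one_of_one_lt₀ hr)
    have h3 := (((h1.const_add (y - y₀)).const_mul 2).div_const (ε ^ 2)).add (h2.div_const ε)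
    rw [add_zero, zero_div, add_zero] at h3
    exact (h3.eventually_lt_const hκ).exists
  obtain ⟨K, hK⟩ := hK
  have hlim : Tendsto (fun i => (2 * (y - y₀ + t ^ K) + 1 / (n i : ℝ)) / ε ^ 2 + r⁻¹ ^ K / ε)
      atTop (𝓝 (2 * (y - y₀ + t ^ K) / ε ^ 2 + r⁻¹ ^ K / ε)) := by
    have := (((tendsto_const_nhds (x := (1 : ℝ))).div_atTop h.tendsto_card_real).const_add
      (2 * (y - y₀ + t ^ K))).div_const (ε ^ 2)
    rw [add_zero] at this
    exact this.add_const _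
  have hlin : Tendsto (fun i => δ * (n i : ℝ)) atTop atTop :=
    h.tendsto_card_real.const_mul_atTop hδ
  filter_upwards [h.eventually_smallCount (by linarith) hy0 hy01 hy1 hg hg1 ht ht1.le hygt hy hy0'
    hg' hε K, hlim.eventually_le_const hK, hlin.eventually_ge_atTop (K : ℝ),
    h.eventually_lt_degree α, h.eventually_secondEigenvalue_le hδ,
    h.tendsto_card_real.eventually_gt_atTop 0] with i hsmall hle hKn hd hsec hn
  have hα0 : 0 < α := by linarith
  have hd0 : (0 : ℝ) < d i := hα0.trans hd
  have h0 : 0 ≤ α / d i := by positivity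
  have h1 : α / d i ≤ 1 := (div_le_one hd0).2 hd.le
  -- The vertices whose clusters have size between `K` and `δ * n i`. They are rare on average, so
  -- counting up to `K` or up to `δ * n i` makes little difference.
  let T : Fin (n i) → Set (Finset (Sym2 (Fin (n i)))) := fun v =>
    {F | ((cluster F v).card : ℝ) ≤ δ * n i ∧ r ^ K ≤ r ^ (cluster F v).card}
  have hT : ∀ v, bernoulliProb (α / d i) (G i).edgeFinset (T v) ≤ r⁻¹ ^ K := by
    intro v
    have := bernoulliProb_cluster_medium (h.regular i) hδ1 hsec hα hd
      (by positivity : 0 < r ^ K) v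
    rwa [Fintype.card_fin, one_div, ← inv_pow] at this
  have hcount : bernoulliProb (α / d i) (G i).edgeFinset
      {F | ε * n i ≤ ((Finset.univ.filter fun v => F ∈ T v).card : ℝ)} ≤ r⁻¹ ^ K / ε := by
    refine (bernoulliProb.markov h0 h1 (c := ε * n i)
      (f := fun F => ((Finset.univ.filter fun v => F ∈ T v).card : ℝ))
      (fun F _ => by positivity) (by positivity) fun F _ hF => hF).trans ?_
    rw [bernoulliProb.mean_card_filter]
    calc _ ≤ (∑ _v : Fin (n i), r⁻¹ ^ K) / (ε * n i) := by
          gcongr with v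
          exact hT v
      _ = r⁻¹ ^ K / ε := by
          simp only [Finset.sum_const, Finset.card_univ, Fintype.card_fin, nsmul_eq_mul]
          field_simp
  refine (bernoulliProb.le_add h0 h1 (fun F _ hF => ?_)).trans
    ((add_le_add hsmall hcount).trans hle)
  by_contra! hcon
  have hc1 : |(smallCount K F : ℝ) - y * n i| < ε * n i := not_le.1 hcon.1
  have hc2 : ((Finset.univ.filter fun v => F ∈ T v).card : ℝ) < ε * n i := not_le.1 hcon.2
  have hF' : 2 * ε * n i ≤ |(smallCount (δ * n i) F : ℝ) - y * n i| := hF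
  have hlow : smallCount K F ≤ smallCount (δ * n i) F :=
    Finset.card_le_card (Finset.monotone_filter_right _ fun v _ hv => hv.trans hKn)
  have hupp : smallCount (δ * n i) F ≤
      smallCount K F + (Finset.univ.filter fun v => F ∈ T v).card := by
    refine (Finset.card_le_card fun v hv => ?_).trans (Finset.card_union_le _ _)
    have hv' := (Finset.mem_filter.1 hv).2
    rcases le_total ((cluster F v).card) K with hvK | hvK
    · exact Finset.mem_union_left _ (Finset.mem_filter.2 ⟨Finset.mem_univ v, by exact_mod_cast hvK⟩)
    · exact Finset.mem_union_right _ (Finset.mem_filter.2 ⟨Finset.mem_univ v, hv',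
        pow_le_pow_right₀ hr.le hvK⟩)
  have hlow' : (smallCount K F : ℝ) ≤ smallCount (δ * n i) F := by exact_mod_cast hlow
  have hupp' : (smallCount (δ * n i) F : ℝ) ≤
      smallCount K F + (Finset.univ.filter fun v => F ∈ T v).card := by exact_mod_cast hupp
  rw [abs_lt] at hc1
  rcases le_abs.1 hF' with h2 | h2 <;> nlinarith [mul_pos hε hn]

end IsPseudoRandomSeq

/-! ### Uniqueness of the large cluster -/

section Giant

variable {V : Type*} [Fintype V] [DecidableEq V]

lemma card_large_add_smallCount (s : ℝ) (F : Finset (Sym2 V)) :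
    ((Finset.univ.filter fun v => s < ((cluster F v).card : ℝ)).card : ℝ) + smallCount s F =
      Fintype.card V := by
  have := Finset.card_filter_add_card_filter_not (s := (Finset.univ : Finset V))
    (fun v => s < ((cluster F v).card : ℝ))
  simp only [not_lt, Finset.card_univ] at this
  exact_mod_cast this

/-- If the large clusters of `F₁` are all joined in `F`, and the numbers of vertices in large
clusters of `F₁` and `F` are close, then `F` has a unique large cluster. -/
lemma exists_giant {F₁ F : Finset (Sym2 V)} (hF : F₁ ⊆ F) {δ y ε : ℝ} (hδε : 4 * ε ≤ δ)
    (hyε : y + 2 * ε < 1) (hn : 0 < Fintype.card V)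
    (h₁ : |(smallCount (δ * Fintype.card V) F₁ : ℝ) - y * Fintype.card V| <
      2 * ε * Fintype.card V)
    (h : |(smallCount (δ * Fintype.card V) F : ℝ) - y * Fintype.card V| <
      2 * ε * Fintype.card V)
    (hconn : ∀ v w, δ * Fintype.card V ≤ (cluster F₁ v).card →
      δ * Fintype.card V ≤ (cluster F₁ w).card → w ∈ cluster F v) :
    ∃ v, |((cluster F v).card : ℝ) - (1 - y) * Fintype.card V| ≤ 2 * ε * Fintype.card V ∧
      δ * Fintype.card V < (cluster F v).card ∧
      ∀ w ∉ cluster F v, ((cluster F w).card : ℝ) ≤ δ * Fintype.card V := by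
  have e₁ := card_large_add_smallCount (δ * Fintype.card V) F₁
  have e := card_large_add_smallCount (δ * Fintype.card V) F
  set n : ℝ := (Fintype.card V : ℝ) with hn'
  have hn0 : 0 < n := by rw [hn']; exact_mod_cast hn
  set L₁ := Finset.univ.filter fun v => δ * n < ((cluster F₁ v).card : ℝ) with hL₁
  set L := Finset.univ.filter fun v => δ * n < ((cluster F v).card : ℝ) with hL
  rw [abs_lt] at h₁ h
  have hL₁card : (1 - y - 2 * ε) * n < L₁.card := by nlinarith
  have hLcard : (L.card : ℝ) < (1 - y + 2 * ε) * n := by nlinarith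
  have hpos : 0 < L₁.card := by
    have : (0 : ℝ) < L₁.card := lt_trans (mul_pos (by linarith) hn0) hL₁card
    exact_mod_cast this
  obtain ⟨v, hv⟩ := Finset.card_pos.1 hpos
  have hv' : δ * n < (cluster F₁ v).card := (Finset.mem_filter.1 hv).2
  have hsub : L₁ ⊆ cluster F v := fun w hw => hconn v w hv'.le (Finset.mem_filter.1 hw).2.le
  have hlarge : δ * n < (cluster F v).card :=
    hv'.trans_le (by exact_mod_cast Finset.card_le_card (cluster_mono hF v))
  have hcl : ∀ u, δ * n < (cluster F u).card → cluster F u ⊆ L := fun u hu w hw =>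
    Finset.mem_filter.2 ⟨Finset.mem_univ w, by rwa [cluster_eq_of_mem hw]⟩
  have hle₁ : (L₁.card : ℝ) ≤ (cluster F v).card := by exact_mod_cast Finset.card_le_card hsub
  have hle : ((cluster F v).card : ℝ) ≤ L.card := by
    exact_mod_cast Finset.card_le_card (hcl v hlarge)
  refine ⟨v, abs_le.2 ⟨by linarith, by linarith⟩, hlarge, fun w hw => ?_⟩
  by_contra! hcon
  have hun := Finset.card_le_card (Finset.union_subset (hcl v hlarge) (hcl w hcon))
  rw [Finset.card_union_of_disjoint (disjoint_cluster hw)] at hun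
  -- A second large cluster would need more than `δ * n ≥ 4 * ε * n` further vertices of `L`, but
  -- `L` exceeds `L₁` by less than that.
  have hun' : ((cluster F v).card : ℝ) + (cluster F w).card ≤ L.card := by exact_mod_cast hun
  nlinarith

/-- Uniqueness does not use the size estimate: any other candidate would force the cluster of `v` to
have at most `l` vertices. -/
lemma existsUnique_component {F : Finset (Sym2 V)} {s a l : ℝ} {v : V}
    (hv : |((cluster F v).card : ℝ) - a| ≤ s) (hl : l < (cluster F v).card)
    (h : ∀ w ∉ cluster F v, ((cluster F w).card : ℝ) ≤ l) :
    ∃! c : (SimpleGraph.fromEdgeSet (F : Set (Sym2 V))).ConnectedComponent,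
      |(componentSize c : ℝ) - a| ≤ s ∧ ∀ c', c' ≠ c → (componentSize c' : ℝ) ≤ l := by
  refine ⟨SimpleGraph.connectedComponentMk _ v, ⟨?_, fun c' => ?_⟩, fun c' ⟨_, hc'⟩ => ?_⟩
  · rwa [componentSize_connectedComponentMk]
  · refine SimpleGraph.ConnectedComponent.ind (fun w hw => ?_) c'
    rw [componentSize_connectedComponentMk]
    exact h w fun hmem => hw (connectedComponentMk_eq_iff.2 hmem).symm
  · by_contra hne
    have := hc' _ (Ne.symm hne)
    rw [componentSize_connectedComponentMk] at this
    linarith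

end Giant

/-! ### Sprinkling -/

/-- A union bound for an event that depends on both rounds of a two-round exposure. -/
lemma bernoulliProb_sprinkle_le {ι : Type*} [DecidableEq ι] {p p₁ p₂ c : ℝ}
    (h : 1 - p = (1 - p₁) * (1 - p₂)) (h0 : 0 ≤ p₁) (h1 : p₁ ≤ 1) (h0' : 0 ≤ p₂) (h1' : p₂ ≤ 1)
    {E : Finset ι} {S S₁ S₂ : Set (Finset ι)} {S₃ : Finset ι → Set (Finset ι)}
    (hS : ∀ F₁ F₂ : Finset ι, F₁ ∪ F₂ ∈ S → F₁ ∪ F₂ ∈ S₁ ∨ F₁ ∈ S₂ ∨ F₂ ∈ S₃ F₁)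
    (hS₃ : ∀ F₁, bernoulliProb p₂ E (S₃ F₁) ≤ c) :
    bernoulliProb p E S ≤ bernoulliProb p E S₁ + bernoulliProb p₁ E S₂ + c := by
  have hnn : ∀ (T : Set (Finset ι)) (F : Finset ι), 0 ≤ T.indicator (1 : Finset ι → ℝ) F :=
    fun T F => Set.indicator_nonneg (by simp) F
  have hpt : ∀ F₁ F₂ : Finset ι, S.indicator (1 : Finset ι → ℝ) (F₁ ∪ F₂) ≤
      S₁.indicator 1 (F₁ ∪ F₂) + S₂.indicator 1 F₁ + (S₃ F₁).indicator 1 F₂ := by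
    intro F₁ F₂
    have a1 := hnn S₁ (F₁ ∪ F₂)
    have a2 := hnn S₂ F₁
    have a3 := hnn (S₃ F₁) F₂
    by_cases hm : F₁ ∪ F₂ ∈ S
    · rw [Set.indicator_of_mem hm]
      rcases hS F₁ F₂ hm with hh | hh | hh
      all_goals
        have := Set.indicator_of_mem hh (1 : Finset ι → ℝ)
        simp only [Pi.one_apply] at this ⊢
        linarith
    · rw [Set.indicator_of_notMem hm]
      linarith
  calc bernoulliProb p E S
      = bernoulliMean p₁ E (fun F₁ => bernoulliMean p₂ E (fun F₂ =>
          S.indicator 1 (F₁ ∪ F₂))) := bernoulliMean.sprinkle h E _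
    _ ≤ bernoulliMean p₁ E (fun F₁ => bernoulliMean p₂ E (fun F₂ =>
          S₁.indicator 1 (F₁ ∪ F₂)) + S₂.indicator 1 F₁ + c) := by
        refine bernoulliMean.mono h0 h1 fun F₁ _ => ?_
        refine (bernoulliMean.mono h0' h1' fun F₂ _ => hpt F₁ F₂).trans ?_
        rw [bernoulliMean.add, bernoulliMean.add, bernoulliMean.const]
        exact add_le_add le_rfl (hS₃ F₁)
    _ = _ := by
        rw [bernoulliMean.add, bernoulliMean.add, bernoulliMean.const,
          ← bernoulliMean.sprinkle h]
        rfl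

namespace IsPseudoRandomSeq

variable {n d : ℕ → ℕ} {G : (i : ℕ) → SimpleGraph (Fin (n i))} [∀ i, DecidableRel (G i).Adj]

/-- Sprinkling: the large clusters at a slightly smaller edge probability are joined. -/
lemma eventually_sprinkle (h : IsPseudoRandomSeq n d G) {α α₁ δ κ : ℝ} (hα₁ : 0 ≤ α₁)
    (hα : α₁ < α) (hδ : 0 < δ) (hκ : 0 < κ) :
    ∀ᶠ i in atTop, ∃ p₂ : ℝ, 0 ≤ p₂ ∧ p₂ ≤ 1 ∧ 1 - α / d i = (1 - α₁ / d i) * (1 - p₂) ∧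
      ∀ F₁ : Finset (Sym2 (Fin (n i))), bernoulliProb p₂ (G i).edgeFinset
        {F₂ | ∃ v w, δ * n i ≤ (cluster F₁ v).card ∧ δ * n i ≤ (cluster F₁ w).card ∧
          w ∉ cluster (F₁ ∪ F₂) v} ≤ κ := by
  set b := (α - α₁) * (δ ^ 2 / 2) with hb
  have hb0 : 0 < b := mul_pos (by linarith) (by positivity)
  have hlim : Tendsto (fun i => (n i : ℝ) ^ 2 * Real.exp (-(b * n i))) atTop (𝓝 0) := by
    have h1 := (Real.tendsto_pow_mul_exp_neg_atTop_nhds_zero 2).comp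
      (h.tendsto_card_real.const_mul_atTop hb0)
    have h2 := h1.const_mul (b ^ 2)⁻¹
    rw [mul_zero] at h2
    refine h2.congr fun i => ?_
    simp only [Function.comp]
    field_simp
  filter_upwards [hlim.eventually_le_const hκ, h.eventually_lt_degree α,
    h.eventually_secondEigenvalue_le (by positivity : 0 < δ ^ 2 / 2),
    h.eventually_secondEigenvalue_le (by norm_num : (0 : ℝ) < 1 / 2)] with i hi hd hsec hsec'
  have hd0 : (0 : ℝ) < d i := by linarith
  have hq : 0 < 1 - α₁ / d i := by
    rw [sub_pos, div_lt_one hd0]; linarith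
  have hαd : 0 < 1 - α / d i := by
    rw [sub_pos, div_lt_one hd0]; linarith
  have hdd : α₁ / d i ≤ α / d i := by gcongr
  -- The second round keeps an edge with probability at least `(α - α₁) / d i`.
  have hle : (1 - α / d i) / (1 - α₁ / d i) ≤ 1 - (α - α₁) / d i := by
    rw [div_le_iff₀ hq, sub_div]
    have : 0 ≤ α₁ / d i := by positivity
    nlinarith
  have hexp : (1 - α / d i) / (1 - α₁ / d i) ≤ Real.exp (-((α - α₁) / d i)) :=
    hle.trans (by have := Real.add_one_le_exp (-((α - α₁) / d i)); linarith)
  have hle1 : (1 - α / d i) / (1 - α₁ / d i) ≤ 1 := by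
    rw [div_le_one hq]; linarith
  have hge0 : 0 ≤ (1 - α / d i) / (1 - α₁ / d i) := by positivity
  refine ⟨1 - (1 - α / d i) / (1 - α₁ / d i), by linarith, by linarith, ?_, fun F₁ => ?_⟩
  · rw [sub_sub_cancel, mul_div_cancel₀ _ hq.ne']
  have h0 : 0 ≤ 1 - (1 - α / d i) / (1 - α₁ / d i) := by linarith
  have h1 : 1 - (1 - α / d i) / (1 - α₁ / d i) ≤ 1 := by linarith
  set p₂ := 1 - (1 - α / d i) / (1 - α₁ / d i) with hp₂
  calc _ ≤ ∑ x : Fin (n i) × Fin (n i), bernoulliProb p₂ (G i).edgeFinset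
        {F₂ | δ * n i ≤ (cluster F₁ x.1).card ∧ δ * n i ≤ (cluster F₁ x.2).card ∧
          x.2 ∉ cluster (F₁ ∪ F₂) x.1} :=
        bernoulliProb.le_sum h0 h1 _ fun F _ hF => by
          obtain ⟨v, w, hvw⟩ := hF
          exact ⟨(v, w), Finset.mem_univ _, hvw⟩
    _ ≤ ∑ _x : Fin (n i) × Fin (n i), Real.exp (-(b * n i)) := by
        refine Finset.sum_le_sum fun x _ => ?_
        by_cases hx : δ * n i ≤ (cluster F₁ x.1).card ∧ δ * n i ≤ (cluster F₁ x.2).card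
        · have := bernoulliProb_not_connected_le (h.regular i) hδ.le h0 h1
            (by linarith : 0 ≤ α - α₁) (by rw [hp₂, sub_sub_cancel]; exact hexp)
            (by exact_mod_cast hd0) (by linarith) hsec F₁ x.1 x.2
            (by simpa using hx.1) (by simpa using hx.2)
          rw [Fintype.card_fin] at this
          exact (bernoulliProb.mono h0 h1 fun F _ hF => hF.2.2).trans this
        · refine (bernoulliProb.mono (T := ∅) h0 h1 fun F _ hF => hx ⟨hF.1, hF.2.1⟩).trans ?_
          rw [bernoulliProb, Set.indicator_empty, bernoulliMean.const]
          exact (Real.exp_pos _).le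
    _ = (n i : ℝ) ^ 2 * Real.exp (-(b * n i)) := by
        simp only [Finset.sum_const, Finset.card_univ, Fintype.card_prod, Fintype.card_fin,
          nsmul_eq_mul, Nat.cast_mul]
        ring
    _ ≤ κ := hi

end IsPseudoRandomSeq

/-- Turns the threshold `n ^ 2` of the union bounds into a logarithmic size bound, with constant `2
/ log r`. -/
lemma le_of_pow_lt_sq {r m : ℝ} {k : ℕ} (hr : 1 < r) (h : r ^ k < m ^ 2) :
    (k : ℝ) ≤ 2 / Real.log r * Real.log m := by
  have hlog := Real.log_pos hr
  have h1 := Real.log_lt_log (by positivity) h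
  rw [Real.log_pow, Real.log_pow] at h1
  rw [div_mul_eq_mul_div, le_div_iff₀ hlog]
  exact_mod_cast h1.le

/-! ### Choice of parameters -/

/-- The conditions on the parameters of a random subgraph with edge probability `α / d` under
which the number of vertices in small clusters is bounded by means of `y`, `y₀`, `g` and `t`. -/
def AdmissibleAt (δ y y₀ g t α : ℝ) : Prop :=
  1 < α ∧ Real.exp (-(α * (1 - y))) < y ∧ y₀ < Real.exp (-(α * (1 - y₀))) ∧
    Real.exp (-(α * (1 - g))) < t * g ∧ 1 < Real.exp (α * (1 - 2 * δ) - 1) / α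

/-- A choice of parameters that works at `α` and at some `α₁ < α`. -/
lemma exists_admissible {α η δ ε κ : ℝ} (hα : 1 < α) (hη0 : 0 < η) (hη1 : η < 1)
    (hup : ∀ y, η < y → y < 1 → Real.exp (-(α * (1 - y))) < y)
    (hdown : ∀ y, y < η → y < Real.exp (-(α * (1 - y)))) (hδ : 0 < δ)
    (hr : 1 < Real.exp (α * (1 - 2 * δ) - 1) / α) (hε : 0 < ε) (hκ : 0 < κ) :
    ∃ α₁ e y y₀ g t : ℝ, α₁ < α ∧ 0 < e ∧ 3 * e ≤ ε ∧ 4 * e ≤ δ ∧ y + 2 * e < 1 ∧ 0 ≤ y₀ ∧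
      y₀ ≤ y ∧ y ≤ 1 ∧ 0 ≤ g ∧ g ≤ 1 ∧ 0 ≤ t ∧ t < 1 ∧ y₀ ≤ g * t ∧ |y - η| ≤ e ∧
      2 * (y - y₀) / e ^ 2 < κ / 4 ∧ AdmissibleAt δ y y₀ g t α ∧ AdmissibleAt δ y y₀ g t α₁ := by
  have hα0 : 0 < α := by linarith
  obtain ⟨e, he0, he⟩ := exists_between
    (show 0 < min (ε / 3) (min (δ / 4) ((1 - η) / 4)) from
      lt_min (by positivity) (lt_min (by positivity) (by linarith)))
  rw [lt_min_iff, lt_min_iff] at he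
  -- The bracket around `η` has width `2 * ρ`. The bound by `κ / 4 * e ^ 2 / 4` makes the Chebyshev
  -- error small, and `ρ < η` keeps `y₀` positive.
  obtain ⟨ρ, hρ0, hρ⟩ := exists_between
    (show 0 < min e (min η (κ / 4 * e ^ 2 / 4)) from
      lt_min he0 (lt_min hη0 (by positivity)))
  rw [lt_min_iff, lt_min_iff] at hρ
  set y := η + ρ with hy
  set y₀ := η - ρ with hy₀
  have hy1 : y < 1 := by linarith
  have hyy : 2 * (y - y₀) / e ^ 2 < κ / 4 := by
    rw [div_lt_iff₀ (by positivity)]; linarith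
  set g := (η + 1) / 2 with hg
  have hg1 : g < 1 := by linarith
  have hg0 : 0 < g := by linarith
  -- Such `t < 1` exists because `y₀ < η < g` and `g` lies strictly between the fixed points `η` and
  -- 1.
  obtain ⟨t, ht, ht1⟩ := exists_between
    (show max (y₀ / g) (Real.exp (-(α * (1 - g))) / g) < 1 from max_lt
      (by rw [div_lt_one hg0]; linarith)
      (by rw [div_lt_one hg0]; exact hup g (by linarith) hg1))
  rw [max_lt_iff, div_lt_iff₀ hg0, div_lt_iff₀ hg0] at ht
  have ht0 : 0 ≤ t := by
    by_contra! hneg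
    have := ht.2.trans (mul_neg_of_neg_of_pos hneg hg0)
    exact absurd this (Real.exp_pos _).not_gt
  -- All conditions at `α` are strict and continuous in the parameter. The same `y` therefore serves
  -- both rounds, and this makes their counts comparable.
  have hcont : ∀ᶠ a in 𝓝[<] α, 1 < a ∧ Real.exp (-(a * (1 - y))) < y ∧
      y₀ < Real.exp (-(a * (1 - y₀))) ∧ Real.exp (-(a * (1 - g))) < t * g ∧
      1 < Real.exp (a * (1 - 2 * δ) - 1) / a := by
    refine nhdsWithin_le_nhds ?_
    have c1 : ∀ z : ℝ, ContinuousAt (fun a : ℝ => Real.exp (-(a * (1 - z)))) α := fun z => by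
      fun_prop
    have c2 : ContinuousAt (fun a : ℝ => Real.exp (a * (1 - 2 * δ) - 1) / a) α := by
      refine ContinuousAt.div (by fun_prop) continuousAt_id hα0.ne'
    filter_upwards [eventually_gt_nhds hα, (c1 y).eventually_lt_const (hup y (by linarith) hy1),
      (c1 y₀).eventually_const_lt (hdown y₀ (by linarith)), (c1 g).eventually_lt_const ht.2,
      c2.eventually_const_lt hr] with a h1 h2 h3 h4 h5
    exact ⟨h1, h2, h3, h4, h5⟩
  obtain ⟨α₁, ⟨hα₁, hy', hy₀', hg', hr'⟩, hlt⟩ :=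
    (hcont.and self_mem_nhdsWithin).exists
  refine ⟨α₁, e, y, y₀, g, t, hlt, he0, by linarith, by linarith, by linarith, by linarith,
    by linarith, by linarith, hg0.le, hg1.le, ht0, ht1, by linarith, ?_, hyy,
    ⟨hα, hup y (by linarith) hy1, hdown y₀ (by linarith), ht.2, hr⟩,
    ⟨hα₁, hy', hy₀', hg', hr'⟩⟩
  rw [abs_le]
  constructor <;> linarith

/-! ### The giant cluster -/

namespace IsPseudoRandomSeq

variable {n d : ℕ → ℕ} {G : (i : ℕ) → SimpleGraph (Fin (n i))} [∀ i, DecidableRel (G i).Adj]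

/-- The bound on the small clusters is of smaller order than the number of vertices. -/
lemma eventually_log_lt (h : IsPseudoRandomSeq n d G) {C δ : ℝ} (hC : 0 < C) (hδ : 0 < δ) :
    ∀ᶠ i in atTop, C * Real.log (n i) < δ * n i := by
  have hlog := (Real.isLittleO_log_id_atTop.comp_tendsto h.tendsto_card_real).bound
    (show 0 < δ / (2 * C) by positivity)
  filter_upwards [hlog, h.tendsto_card_real.eventually_gt_atTop 0] with i hi hn
  simp only [Function.comp, id, Real.norm_eq_abs, abs_of_pos hn] at hi
  have h1 : C * Real.log (n i) ≤ C * (δ / (2 * C) * n i) := by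
    gcongr
    exact (le_abs_self _).trans hi
  have h2 : C * (δ / (2 * C) * n i) = δ * n i / 2 := by
    field_simp
  have : 0 < δ * n i := by positivity
  linarith

/-- In the supercritical case there is a unique giant cluster. -/
lemma eventually_giant (h : IsPseudoRandomSeq n d G) {α β δ r : ℝ} (hα : 1 < α) (hβ0 : 0 < β)
    (hβ1 : β < 1) (hlow : ∀ x, x < β → x * Real.exp (-x) < α * Real.exp (-α))
    (hmid : ∀ x, β < x → x < α → α * Real.exp (-α) < x * Real.exp (-x)) (hδ : 0 < δ)
    (hδ1 : δ < 1) (hr : r = Real.exp (α * (1 - 2 * δ) - 1) / α) (hr1 : 1 < r) {ε κ : ℝ}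
    (hε : 0 < ε) (hκ : 0 < κ) :
    ∀ᶠ i in atTop, bernoulliProb (α / d i) (G i).edgeFinset
      {F | ¬ ∃ v, |((cluster F v).card : ℝ) - (1 - β / α) * n i| ≤ ε * n i ∧
        2 / Real.log r * Real.log (n i) < (cluster F v).card ∧
        ∀ w ∉ cluster F v, ((cluster F w).card : ℝ) ≤ 2 / Real.log r * Real.log (n i)} ≤ κ := by
  have hα0 : 0 < α := by linarith
  set η := β / α with hη
  have hη0 : 0 < η := by positivity
  have hη1 : η < 1 := by rw [hη, div_lt_one hα0]; linarith
  have hup : ∀ y, η < y → y < 1 → Real.exp (-(α * (1 - y))) < y := fun y hy hy1 => by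
    rw [exp_lt_iff_mul_exp_neg hα0]
    refine hmid _ ?_ (mul_lt_of_lt_one_right hα0 hy1)
    rwa [hη, div_lt_iff₀' hα0] at hy
  have hdown : ∀ y, y < η → y < Real.exp (-(α * (1 - y))) := fun y hy => by
    rw [lt_exp_iff_mul_exp_neg hα0]
    refine hlow _ ?_
    rwa [hη, lt_div_iff₀' hα0] at hy
  obtain ⟨α₁, e, y, y₀, g, t, hlt, he0, heε, heδ, hye, hy₀0, hy₀y, hy1, hg0, hg1, ht0, ht1, hygt,
    hyη, hyy, ⟨-, hy, hy₀, hg, hr'⟩, ⟨hα₁, hy', hy₀', hg', hr₁⟩⟩ :=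
    exists_admissible hα hη0 hη1 hup hdown hδ (hr ▸ hr1) hε hκ
  have hκ4 : 0 < κ / 4 := by positivity
  have hN := h.eventually_smallCount_linear hα hy₀0 hy₀y hy1 hg0 hg1 ht0 ht1 hygt hy hy₀ hg he0 hδ
    hδ1 hr' hyy
  have hN₁ := h.eventually_smallCount_linear hα₁ hy₀0 hy₀y hy1 hg0 hg1 ht0 ht1 hygt hy' hy₀' hg'
    he0 hδ hδ1 hr₁ hyy
  -- Needed for uniqueness: the giant cluster must exceed the logarithmic bound placed on the
  -- others.
  have hlogn := h.eventually_log_lt (C := 2 / Real.log r)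
    (by have := Real.log_pos hr1; positivity) hδ
  filter_upwards [hN, hN₁, h.eventually_no_medium hα hδ hδ1 hκ4,
    h.eventually_sprinkle (by linarith) hlt hδ hκ4, hlogn,
    h.tendsto_card.eventually_gt_atTop 0, h.eventually_lt_degree α]
    with i h1 h2 h3 h4 h5 hn hd
  obtain ⟨p₂, hp0, hp1, hpp, h4⟩ := h4
  have hd0 : (0 : ℝ) < d i := by linarith
  have hpα0 : 0 ≤ α / d i := by positivity
  have hpα1 : α / d i ≤ 1 := (div_le_one hd0).2 hd.le
  have hpα₁0 : 0 ≤ α₁ / d i := div_nonneg (by linarith) hd0.le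
  have hpα₁1 : α₁ / d i ≤ 1 := (div_le_one hd0).2 (by linarith)
  have hn0 : (0 : ℝ) < n i := by exact_mod_cast hn
  rw [← hr] at h3
  set S₁ : Set (Finset (Sym2 (Fin (n i)))) :=
    {F | 2 * e * n i ≤ |(smallCount (δ * n i) F : ℝ) - y * n i|} ∪
      {F | ∃ v, ((cluster F v).card : ℝ) ≤ δ * n i ∧ (n i : ℝ) ^ 2 ≤ r ^ (cluster F v).card}
    with hS₁
  have hS₁le : bernoulliProb (α / d i) (G i).edgeFinset S₁ ≤ κ / 4 + κ / 4 :=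
    (bernoulliProb.le_add hpα0 hpα1 fun F _ hF => hF).trans (add_le_add h1 h3)
  refine (bernoulliProb_sprinkle_le hpp hpα₁0 hpα₁1 hp0 hp1 (S₁ := S₁)
    (S₂ := {F | 2 * e * n i ≤ |(smallCount (δ * n i) F : ℝ) - y * n i|})
    (S₃ := fun F₁ => {F₂ | ∃ v w, δ * n i ≤ (cluster F₁ v).card ∧
      δ * n i ≤ (cluster F₁ w).card ∧ w ∉ cluster (F₁ ∪ F₂) v}) ?_ h4).trans
    (by linarith)
  intro F₁ F₂ hF
  by_contra! hcon
  obtain ⟨hc1, hc2, hc3⟩ := hcon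
  rw [hS₁, Set.mem_union, not_or] at hc1
  have hsmall : |(smallCount (δ * n i) (F₁ ∪ F₂) : ℝ) - y * n i| < 2 * e * n i := not_le.1 hc1.1
  have hsmall₁ : |(smallCount (δ * n i) F₁ : ℝ) - y * n i| < 2 * e * n i := not_le.1 hc2
  have hgap : ∀ v, ((cluster (F₁ ∪ F₂) v).card : ℝ) ≤ δ * n i →
      r ^ (cluster (F₁ ∪ F₂) v).card < (n i : ℝ) ^ 2 := fun v hv => by
    by_contra! hge
    exact hc1.2 ⟨v, hv, hge⟩
  have hconn : ∀ v w, δ * n i ≤ (cluster F₁ v).card → δ * n i ≤ (cluster F₁ w).card →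
      w ∈ cluster (F₁ ∪ F₂) v := fun v w hv hw => by
    by_contra hvw
    exact hc3 ⟨v, w, hv, hw, hvw⟩
  obtain ⟨v, hv1, hv2, hv3⟩ := exists_giant (F₁ := F₁) (F := F₁ ∪ F₂) (δ := δ) (y := y) (ε := e)
    Finset.subset_union_left heδ hye (by simpa using hn)
    (by simpa using hsmall₁) (by simpa using hsmall) (by simpa using hconn)
  rw [Fintype.card_fin] at hv1 hv2 hv3
  refine hF ⟨v, ?_, h5.trans hv2, fun w hw => le_of_pow_lt_sq hr1 (hgap w (hv3 w hw))⟩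
  rw [abs_le] at hv1 ⊢
  have hen : 3 * e * n i ≤ ε * n i := by gcongr
  have hyη₁ := mul_le_mul_of_nonneg_right (abs_le.1 hyη).1 hn0.le
  have hyη₂ := mul_le_mul_of_nonneg_right (abs_le.1 hyη).2 hn0.le
  constructor <;> linarith

end IsPseudoRandomSeq

/-! ### Explicit rates and the theorem -/

lemma exists_subcritical_rate {α : ℝ} (hα1 : α < 1) :
    ∃ z f : ℝ, 1 < z ∧ 1 ≤ f ∧ z * Real.exp (α * (f - 1)) ≤ f := by
  refine ⟨(2 - α) * Real.exp (-(α * (1 - α))), 2 - α, ?_, by linarith, ?_⟩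
  · have h1 : 1 - α * (1 - α) ≤ Real.exp (-(α * (1 - α))) := by
      have := Real.add_one_le_exp (-(α * (1 - α))); linarith
    -- With `u = 1 - α`, the lower bound for the first witness is `(1 + u) * (1 - u + u ^ 2) = 1 + u
    -- ^ 3`.
    have h2 : 0 < (1 - α) ^ 3 := pow_pos (by linarith) 3
    nlinarith
  · rw [mul_assoc, ← Real.exp_add]
    have : -(α * (1 - α)) + α * (2 - α - 1) = 0 := by ring
    rw [this, Real.exp_zero, mul_one]

/-- At `δ = 0` the rate is `exp (α - 1) / α`, which exceeds 1 for `1 < α`; continuity leaves room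
for a positive `δ`. -/
lemma exists_supercritical_rate {α : ℝ} (hα : 1 < α) :
    ∃ δ : ℝ, 0 < δ ∧ δ < 1 ∧ 1 < Real.exp (α * (1 - 2 * δ) - 1) / α := by
  have hc : ContinuousAt (fun δ : ℝ => Real.exp (α * (1 - 2 * δ) - 1) / α) 0 := by fun_prop
  have h0 : 1 < Real.exp (α * (1 - 2 * 0) - 1) / α := by
    rw [one_lt_div (by linarith)]
    have := Real.add_one_lt_exp (x := α - 1) (by linarith)
    simpa using this
  have h : ∀ᶠ δ in 𝓝[>] (0 : ℝ), 1 < Real.exp (α * (1 - 2 * δ) - 1) / α :=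
    nhdsWithin_le_nhds (hc.eventually_const_lt h0)
  obtain ⟨δ, h1, h2⟩ := (h.and (Ioo_mem_nhdsGT one_pos)).exists
  exact ⟨δ, h2.1, h2.2, h1⟩

theorem theorem1 (α : ℝ) (hα : 0 ≤ α) :
    -- (a) the subcritical case
    (α < 1 →
      ∃ C : ℝ, ∀ (n d : ℕ → ℕ) (G : (i : ℕ) → SimpleGraph (Fin (n i)))
        [∀ i, DecidableRel (G i).Adj], IsPseudoRandomSeq n d G →
        Tendsto (fun i => (randomSubgraph (G i) (edgeProb α (d i))).real
            {H | ∀ c : H.ConnectedComponent, (componentSize c : ℝ) ≤ C * Real.log (n i)})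
          atTop (𝓝 1)) ∧
    -- (b) the supercritical case
    (1 < α →
      ∃ αbar : ℝ, αbar < 1 ∧
        (∀ x : ℝ, x * Real.exp (-x) = α * Real.exp (-α) ↔ x = αbar ∨ x = α) ∧
        ∃ C : ℝ, ∀ (n d : ℕ → ℕ) (G : (i : ℕ) → SimpleGraph (Fin (n i)))
          [∀ i, DecidableRel (G i).Adj], IsPseudoRandomSeq n d G →
          ∀ ε : ℝ, 0 < ε →
            Tendsto (fun i => (randomSubgraph (G i) (edgeProb α (d i))).real
                {H | ∃! c : H.ConnectedComponent,
                  |(componentSize c : ℝ) - (1 - αbar / α) * n i| ≤ ε * n i ∧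
                  ∀ c' : H.ConnectedComponent, c' ≠ c →
                    (componentSize c' : ℝ) ≤ C * Real.log (n i)})
              atTop (𝓝 1)) := by

  refine ⟨fun hα1 => ?_, fun hα1 => ?_⟩
  · obtain ⟨z, f, hz, hf, hzf⟩ := exists_subcritical_rate hα1
    refine ⟨2 / Real.log z, fun n d G _ h => h.tendsto_randomSubgraph hα _ fun κ hκ => ?_⟩
    filter_upwards [h.eventually_subcritical hα hf hz hzf hκ, h.eventually_lt_degree α]
      with i hi hd
    have hd0 : (0 : ℝ) < d i := hα.trans_lt hd
    refine (bernoulliProb.mono (by positivity) ((div_le_one hd0).2 hd.le) fun F _ hF => ?_).trans hi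
    by_contra hcon
    refine hF fun c => ?_
    refine SimpleGraph.ConnectedComponent.ind (fun v => ?_) c
    rw [componentSize_connectedComponentMk]
    refine le_of_pow_lt_sq hz ?_
    by_contra! hge
    exact hcon ⟨v, hge⟩
  · obtain ⟨β, hβ0, hβ1, hlow, hmid, hiff⟩ := exists_dual hα1
    obtain ⟨δ, hδ, hδ1, hr⟩ := exists_supercritical_rate hα1
    refine ⟨β, hβ1, hiff, 2 / Real.log (Real.exp (α * (1 - 2 * δ) - 1) / α),
      fun n d G _ h ε hε => h.tendsto_randomSubgraph hα _ fun κ hκ => ?_⟩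
    filter_upwards [h.eventually_giant hα1 hβ0 hβ1 hlow hmid hδ hδ1 rfl hr hε hκ,
      h.eventually_lt_degree α] with i hi hd
    have hd0 : (0 : ℝ) < d i := hα.trans_lt hd
    refine (bernoulliProb.mono (by positivity) ((div_le_one hd0).2 hd.le) fun F _ hF => ?_).trans hi
    rintro ⟨v, hv1, hv2, hv3⟩
    exact hF (existsUnique_component hv1 hv2 hv3)
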